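/- Let $R$ and $S$ be associative unital rings; modules are unital left modules, and right modules are identified with left modules over the opposite ring. Let $n,d$ be integers with $d\ge 1$ and $n>d+1$. For an abelian group $M$ put $M^*=\operatorname{Hom}_{\mathbb Z}(M,\mathbb Q/\mathbb Z)$; if $M$ is an $A$-module, then $M^*$ is an $A^{op}$-module via $(fa)(m)=f(am)$. Definitions. For a ring $A$, an $A$-module $U$ is finitely $n$-presented if there is an exact sequence $F_n\to\cdots\to F_1\to F_0\to U\to 0$ with every $F_i$ finitely generated and free, and super finitely presented if there is an infinite such sequence $\cdots\to F_1\to F_0\to U\to 0$. An $A$-module $M$ is $(n,d)$-injective if $\operatorname{Ext}^{d+1}_A(U,M)=0$ for every finitely $n$-presented $A$-module $U$, and an $A$-module $N$ is $(n,d)$-flat if $\operatorname{Tor}_{d+1}^A(U,N)=0$ for every finitely $n$-presented $A^{op}$-module $U$. An $(S,R)$-bimodule $K$ is semidualizing if ${}_SK$ and $K_R$ have resolutions by finitely generated projective modules over $S$ and over $R^{op}$ respectively, the homothety maps $S\to\operatorname{Hom}_{R^{op}}(K,K)$ and $R\to\operatorname{Hom}_S(K,K)$ are bijective, and $\operatorname{Ext}^i_S(K,K)=0=\operatorname{Ext}^i_{R^{op}}(K,K)$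 for all $i\ge 1$. Let $C$ be an $(S,R)$-bimodule which is super finitely presented over $S$ and over $R^{op}$, and let $K=K_{d-1}$ be a special semidualizing $(S,R)$-bimodule with respect to $C$. That is, $K$ is a semidualizing $(S,R)$-bimodule which is a $(d-1)$th syzygy of $C$ on both sides: over each of $S$ and $R^{op}$ there is a resolution $\cdots\to F_1\to F_0\to C\to 0$ by finitely generated free modules with $K\cong\operatorname{Ker}(F_{d-1}\to F_{d-2})$ as modules over that ring, where $F_{-1}=C$. (For instance, this holds if $K$ is semidualizing and is the kernel of $F_{d-1}\to F_{d-2}$ in a resolution of $C$ by bimodules that are finitely generated and free over $S$ and over $R^{op}$.) An $R$-module is $K$-$(n,d)$-injective if it is isomorphic to $\operatorname{Hom}_S(K,I)$ for some $(n,d)$-injective $S$-module $I$. An $S$-module is $K$-$(n,d)$-flat if it is isomorphic to $K\otimes_R F$ for some $(n,d)$-flat $R$-module $F$. Over the opposite rings, $K$ is regarded as an $(R^{op},S^{op})$-bimodule: thus an $R^{op}$-module is $K$-$(n,d)$-flat if it is isomorphic to $K\otimes_{S^{op}}F=F\otimes_S K$ for some $(n,d)$-flat $S^{op}$-module $F$,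 and an $S^{op}$-module is $K$-$(n,d)$-injective if it is isomorphic to $\operatorname{Hom}_{R^{op}}(K,I)$ for some $(n,d)$-injective $R^{op}$-module $I$. Proposition. (1) An $R$-module $M$ is $K_{d-1}$-$(n,d)$-injective if and only if the $R^{op}$-module $M^*$ is $K_{d-1}$-$(n,d)$-flat. (2) An $S$-module $N$ is $K_{d-1}$-$(n,d)$-flat if and only if the $S^{op}$-module $N^*$ is $K_{d-1}$-$(n,d)$-injective. -/

import Mathlib

open CategoryTheory MulOpposite
open scoped TensorProduct

universe u

/-! Right modules over a ring `R` are modules over `Rᵐᵒᵖ`.  An `(S, R)`-bimodule is an abelian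
group with commuting actions of `S` and of `Rᵐᵒᵖ`. -/

/-- The right `R`-module structure `(f r) m = f (r m)` on the character module
`Hom_ℤ(M, ℚ/ℤ)` of a left module `M` over an arbitrary ring `R`. -/
noncomputable instance CharacterModule.moduleOp (R : Type*) [Ring R] (M : Type*) [AddCommGroup M]
    [Module R M] : Module Rᵐᵒᵖ (CharacterModule M) where
  smul r f := AddMonoidHom.comp (show M →+ AddCircle (1 : ℚ) from f)
    (DistribSMul.toAddMonoidHom M r.unop)
  one_smul f := CharacterModule.ext _ fun x => congrArg f (one_smul R x)
  mul_smul r s f := CharacterModule.ext _ fun x => congrArg f (mul_smul s.unop r.unop x)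
  smul_zero _ := CharacterModule.ext _ fun _ => rfl
  smul_add _ _ _ := CharacterModule.ext _ fun _ => rfl
  add_smul r s f := CharacterModule.ext _ fun x =>
    (congrArg f (add_smul r.unop s.unop x)).trans (map_add f _ _)
  zero_smul f := CharacterModule.ext _ fun x =>
    (congrArg f (zero_smul R x)).trans (map_zero f)

theorem CharacterModule.op_smul_apply {R : Type*} [Ring R] {M : Type*} [AddCommGroup M]
    [Module R M] (r : R) (f : CharacterModule M) (m : M) : (op r • f) m = f (r • m) :=
  rfl

/-- An `(S, R)`-bimodule `K` regarded as an `(Rᵐᵒᵖ, Sᵐᵒᵖ)`-bimodule: the left action of `Rᵐᵒᵖ`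
is the right action of `R`, and the right action of `Sᵐᵒᵖ` is the left action of `S`. -/
def OppositeBimodule (K : Type*) : Type _ := K

namespace OppositeBimodule

instance (K : Type*) [AddCommGroup K] : AddCommGroup (OppositeBimodule K) :=
  inferInstanceAs (AddCommGroup K)

instance leftModule (R K : Type*) [Ring R] [AddCommGroup K] [Module Rᵐᵒᵖ K] :
    Module Rᵐᵒᵖ (OppositeBimodule K) :=
  inferInstanceAs (Module Rᵐᵒᵖ K)

instance rightModule (S K : Type*) [Ring S] [AddCommGroup K] [Module S K] :
    Module (Sᵐᵒᵖ)ᵐᵒᵖ (OppositeBimodule K) :=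
  Module.compHom K (RingEquiv.opOp S).symm.toRingHom

instance (S R K : Type*) [Ring S] [Ring R] [AddCommGroup K] [Module S K] [Module Rᵐᵒᵖ K]
    [SMulCommClass S Rᵐᵒᵖ K] : SMulCommClass Rᵐᵒᵖ (Sᵐᵒᵖ)ᵐᵒᵖ (OppositeBimodule K) where
  smul_comm r s k := (smul_comm (unop (unop s)) r (show K from k)).symm

end OppositeBimodule

/-! ### Tensor products, `Tor` and `Ext` over arbitrary rings -/

section Tensor

/-- The submodule of `A ⊗_ℤ B` generated by the elements `(a r) ⊗ b - a ⊗ (r b)`.  As the actions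
of `S` and `Rᵐᵒᵖ` on `A` commute, this set of generators is stable under `S`, so the `S`-submodule
and the subgroup that it generates coincide. -/
def balancedRelations (S R : Type*) [Ring S] [Ring R] (A B : Type*) [AddCommGroup A]
    [AddCommGroup B] [Module S A] [Module Rᵐᵒᵖ A] [SMulCommClass S Rᵐᵒᵖ A] [Module R B] :
    Submodule S (A ⊗[ℤ] B) :=
  Submodule.span S {t | ∃ (a : A) (r : R) (b : B), t = (op r • a) ⊗ₜ[ℤ] b - a ⊗ₜ[ℤ] (r • b)}

/-- The tensor product `A ⊗_R B` of an `(S, R)`-bimodule `A` and a left `R`-module `B`, a left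
`S`-module. -/
abbrev BalancedTensor (S R : Type*) [Ring S] [Ring R] (A B : Type*) [AddCommGroup A]
    [AddCommGroup B] [Module S A] [Module Rᵐᵒᵖ A] [SMulCommClass S Rᵐᵒᵖ A] [Module R B] : Type _ :=
  (A ⊗[ℤ] B) ⧸ balancedRelations S R A B

/-- The map `A ⊗_R B → A' ⊗_R B` induced by a homomorphism `A → A'` of right `R`-modules. -/
noncomputable def BalancedTensor.map (R : Type*) [Ring R] {A A' : Type*} (B : Type*)
    [AddCommGroup A] [AddCommGroup A'] [AddCommGroup B] [Module Rᵐᵒᵖ A] [Module Rᵐᵒᵖ A']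
    [Module R B] (f : A →ₗ[Rᵐᵒᵖ] A') :
    BalancedTensor ℤ R A B →ₗ[ℤ] BalancedTensor ℤ R A' B :=
  Submodule.mapQ _ _ (LinearMap.rTensor B f.toAddMonoidHom.toIntLinearMap) <| by
    rw [balancedRelations, Submodule.span_le]
    rintro _ ⟨a, r, b, rfl⟩
    exact Submodule.subset_span ⟨f a, r, b, by simp⟩

theorem BalancedTensor.map_mk_tmul (R : Type*) [Ring R] {A A' : Type*} (B : Type*)
    [AddCommGroup A] [AddCommGroup A'] [AddCommGroup B] [Module Rᵐᵒᵖ A] [Module Rᵐᵒᵖ A']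
    [Module R B] (f : A →ₗ[Rᵐᵒᵖ] A') (a : A) (b : B) :
    BalancedTensor.map R B f (Submodule.Quotient.mk (a ⊗ₜ[ℤ] b)) =
      Submodule.Quotient.mk (f a ⊗ₜ[ℤ] b) :=
  rfl

theorem BalancedTensor.hom_ext (R : Type*) [Ring R] {A B T : Type*}
    [AddCommGroup A] [AddCommGroup B] [AddCommGroup T] [Module Rᵐᵒᵖ A] [Module R B]
    {f g : BalancedTensor ℤ R A B →ₗ[ℤ] T}
    (h : ∀ (a : A) (b : B), f (Submodule.Quotient.mk (a ⊗ₜ[ℤ] b)) =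
      g (Submodule.Quotient.mk (a ⊗ₜ[ℤ] b))) : f = g := by
  refine Submodule.linearMap_qext _ (LinearMap.ext fun t => ?_)
  induction t using TensorProduct.induction_on with
  | zero => simp
  | tmul a b => exact h a b
  | add x y hx hy => rw [map_add, map_add, hx, hy]

/-- The functor `U ↦ U ⊗_R N` from right `R`-modules to abelian groups. -/
noncomputable def tensorFunctor (R : Type u) [Ring R] (N : Type u) [AddCommGroup N] [Module R N] :
    ModuleCat.{u} Rᵐᵒᵖ ⥤ ModuleCat.{u} ℤ where
  obj U := ModuleCat.of ℤ (BalancedTensor ℤ R U N)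
  map f := ModuleCat.ofHom (BalancedTensor.map R N f.hom)
  map_id _ := ModuleCat.hom_ext (BalancedTensor.hom_ext R fun _ _ => rfl)
  map_comp _ _ := ModuleCat.hom_ext (BalancedTensor.hom_ext R fun _ _ => rfl)

instance (R : Type u) [Ring R] (N : Type u) [AddCommGroup N] [Module R N] :
    (tensorFunctor R N).Additive where
  map_add {U V f g} := ModuleCat.hom_ext <| BalancedTensor.hom_ext R fun a b => by
    change (balancedRelations ℤ R V N).mkQ ((f.hom a + g.hom a) ⊗ₜ[ℤ] b) =
      (balancedRelations ℤ R V N).mkQ (f.hom a ⊗ₜ[ℤ] b) +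
        (balancedRelations ℤ R V N).mkQ (g.hom a ⊗ₜ[ℤ] b)
    rw [TensorProduct.add_tmul, map_add]

/-- `Tor_i^R(U, N)` for a right `R`-module `U` and a left `R`-module `N`. -/
noncomputable def TorGroup (R : Type u) [Ring R] (i : ℕ) (U N : Type u) [AddCommGroup U]
    [AddCommGroup N] [Module Rᵐᵒᵖ U] [Module R N] : ModuleCat.{u} ℤ :=
  ((tensorFunctor R N).leftDerived i).obj (ModuleCat.of Rᵐᵒᵖ U)

/-- `Ext^i_A(U, M)` for left `A`-modules `U` and `M`. -/
abbrev ExtGroup (A : Type u) [Ring A] (i : ℕ) (U M : Type u) [AddCommGroup U]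
    [AddCommGroup M] [Module A U] [Module A M] : Type u :=
  Abelian.Ext (ModuleCat.of A U) (ModuleCat.of A M) i

end Tensor

/-! ### Finiteness conditions and `(n, d)`-injective and `(n, d)`-flat modules -/

/-- An exact sequence `F n → ⋯ → F 1 → F 0 → U → 0` of `A`-modules in which every `F i` is finitely
generated and free; for `n = ⊤` the sequence is infinite to the left.  (For finite `n`, what is
stored in degrees above `n` is irrelevant.) -/
structure FreePresentation (A : Type u) [Ring A] (n : ℕ∞) (U : Type u) [AddCommGroup U]
    [Module A U] where
  F : ℕ → ModuleCat.{u} A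
  d : ∀ i : ℕ, F (i + 1) →ₗ[A] F i
  ε : F 0 →ₗ[A] U
  free : ∀ i : ℕ, (i : ℕ∞) ≤ n → Module.Free A (F i)
  finite : ∀ i : ℕ, (i : ℕ∞) ≤ n → Module.Finite A (F i)
  surjective : Function.Surjective ε
  exact_zero : ((1 : ℕ) : ℕ∞) ≤ n → Function.Exact (d 0) ε
  exact_succ : ∀ i : ℕ, ((i + 2 : ℕ) : ℕ∞) ≤ n → Function.Exact (d (i + 1)) (d i)

/-- Finitely `n`-presented modules. -/
def IsFinitelyNPresented (A : Type u) [Ring A] (n : ℕ) (U : Type u) [AddCommGroup U]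
    [Module A U] : Prop :=
  Nonempty (FreePresentation A n U)

/-- `K` is the syzygy `K_{d-1} = Ker (F_{d-1} → F_{d-2})` of `C` in the resolution
`⋯ → F_1 → F_0 → C → 0`, up to isomorphism, where `F_{-1} = C` and `K_{-1} = C`. -/
def FreePresentation.IsSyzygy {A : Type u} [Ring A] {C : Type u} [AddCommGroup C] [Module A C]
    (P : FreePresentation A ⊤ C) (K : Type u) [AddCommGroup K] [Module A K] : ℕ → Prop
  | 0 => Nonempty (K ≃ₗ[A] C)
  | 1 => Nonempty (K ≃ₗ[A] LinearMap.ker P.ε)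
  | d + 2 => Nonempty (K ≃ₗ[A] LinearMap.ker (P.d d))

/-- `X` has a resolution `⋯ → P 1 → P 0 → X → 0` by finitely generated projective `A`-modules. -/
def HasDegreewiseFiniteProjectiveResolution (A : Type u) [Ring A] (X : Type u) [AddCommGroup X]
    [Module A X] : Prop :=
  ∃ (P : ℕ → ModuleCat.{u} A) (d : ∀ i : ℕ, P (i + 1) →ₗ[A] P i) (ε : P 0 →ₗ[A] X),
    (∀ i, Module.Projective A (P i)) ∧ (∀ i, Module.Finite A (P i)) ∧
    Function.Surjective ε ∧ Function.Exact (d 0) ε ∧ ∀ i, Function.Exact (d (i + 1)) (d i)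

/-- `(n, d)`-injective left `A`-modules. -/
def IsNDInjective (A : Type u) [Ring A] (n d : ℕ) (M : Type u) [AddCommGroup M]
    [Module A M] : Prop :=
  ∀ (U : Type u) [AddCommGroup U] [Module A U], IsFinitelyNPresented A n U →
    Subsingleton (ExtGroup A (d + 1) U M)

/-- `(n, d)`-flat left `A`-modules. -/
def IsNDFlat (A : Type u) [Ring A] (n d : ℕ) (N : Type u) [AddCommGroup N]
    [Module A N] : Prop :=
  ∀ (U : Type u) [AddCommGroup U] [Module Aᵐᵒᵖ U], IsFinitelyNPresented Aᵐᵒᵖ n U →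
    Subsingleton (TorGroup A (d + 1) U N)

/-! ### Semidualizing bimodules -/

section Bimodule

variable (S R : Type u) [Ring S] [Ring R]

/-- Semidualizing `(S, R)`-bimodules. The two homothety maps are `S → Hom_{Rᵐᵒᵖ}(K, K)`,
`s ↦ (k ↦ s k)`, and `R → Hom_S(K, K)`, `r ↦ (k ↦ k r)`. -/
structure IsSemidualizing (K : Type u) [AddCommGroup K] [Module S K] [Module Rᵐᵒᵖ K]
    [SMulCommClass S Rᵐᵒᵖ K] : Prop where
  left_resolution : HasDegreewiseFiniteProjectiveResolution S K
  right_resolution : HasDegreewiseFiniteProjectiveResolution Rᵐᵒᵖ K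
  left_homothety : Function.Bijective fun s : S =>
    (DistribSMul.toLinearMap Rᵐᵒᵖ K s : K →ₗ[Rᵐᵒᵖ] K)
  right_homothety :
    haveI : SMulCommClass Rᵐᵒᵖ S K := SMulCommClass.symm S Rᵐᵒᵖ K
    Function.Bijective fun r : R => (DistribSMul.toLinearMap S K (op r) : K →ₗ[S] K)
  left_ext : ∀ i : ℕ, 1 ≤ i → Subsingleton (ExtGroup S i K K)
  right_ext : ∀ i : ℕ, 1 ≤ i → Subsingleton (ExtGroup Rᵐᵒᵖ i K K)

/-- `K` is a special semidualizing `(S, R)`-bimodule with respect to the `(S, R)`-bimodule `C`: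
`C` is super finitely presented on both sides, `K` is the `(d-1)`-th syzygy `K_{d-1}` of `C` both
over `S` and over `Rᵐᵒᵖ`, and `K` is semidualizing. -/
structure IsSpecialSemidualizing (d : ℕ) (C K : Type u)
    [AddCommGroup C] [Module S C] [Module Rᵐᵒᵖ C] [SMulCommClass S Rᵐᵒᵖ C]
    [AddCommGroup K] [Module S K] [Module Rᵐᵒᵖ K] [SMulCommClass S Rᵐᵒᵖ K] : Prop where
  left_syzygy : ∃ P : FreePresentation S ⊤ C, P.IsSyzygy K d
  right_syzygy : ∃ P : FreePresentation Rᵐᵒᵖ ⊤ C, P.IsSyzygy K d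
  semidualizing : IsSemidualizing S R K

/-- The left `R`-module `M` is isomorphic to `Hom_S(K, I)`, with `(r f) k = f (k r)`, for some
`(n, d)`-injective left `S`-module `I`. -/
def IsRelNDInjective (n d : ℕ) (K M : Type u) [AddCommGroup K] [Module S K] [Module Rᵐᵒᵖ K]
    [SMulCommClass S Rᵐᵒᵖ K] [AddCommGroup M] [Module R M] : Prop :=
  ∃ (I : Type u) (_ : AddCommGroup I) (_ : Module S I), IsNDInjective S n d I ∧
    ∃ e : M ≃+ (K →ₗ[S] I), ∀ (r : R) (m : M) (k : K), e (r • m) k = e m (op r • k)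

/-- The left `S`-module `N` is isomorphic to `K ⊗_R F` for some `(n, d)`-flat left `R`-module
`F`. -/
def IsRelNDFlat (n d : ℕ) (K N : Type u) [AddCommGroup K] [Module S K] [Module Rᵐᵒᵖ K]
    [SMulCommClass S Rᵐᵒᵖ K] [AddCommGroup N] [Module S N] : Prop :=
  ∃ (F : Type u) (_ : AddCommGroup F) (_ : Module R F), IsNDFlat R n d F ∧
    Nonempty (N ≃ₗ[S] BalancedTensor S R K F)

end Bimodule

/-! Write X^* for the character dual; ℚ/ℤ is an injective cogenerator, so dualizing preserves and
reflects exactness and isomorphisms. Characters of U ⊗ F are homomorphisms U → F^*, so a Tor group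
of (U, F) vanishes exactly when the Ext group of (U, F^*) does, and F is (n,d)-flat iff F^* is
(n,d)-injective. With (K ⊗_R F)^* ≅ Hom(K, F^*) this gives the forward half of (2).

The key to the rest is that for an (n,d)-injective module I over T = Rᵐᵒᵖ (or, on the other side, T
= S), the evaluation of Hom_T(K, I) against K is an isomorphism onto I. As K is a d-fold syzygy of a
super finitely presented module, all Ext_T^{j+1}(K, I) vanish by dimension shifting. Apply Hom_S(-,
K) to a finite free resolution of K over S: since Hom_S(K, K) = T and the higher Ext_S(K, K) vanish,
this is an exact coresolution 0 → T → K^m → K^l → ⋯ whose cosyzygies are super finitely presented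
over T. Shifting along it up to degree d+1 shows that Hom_T(-, I) keeps its start exact, so I is
presented by copies of Hom_T(K, I) with the relation matrix of K
(`IsSyzygyDualizing.exists_matrixPresentation`). If N^* ≅ Hom_T(K, I), the same matrix presents
Hom_S(K, N)^*; hence I ≅ Hom_S(K, N)^*, F = Hom_S(K, N) is (n,d)-flat, and K ⊗ F → N is an
isomorphism because its dual is.

Part (1) is reduced to such dual statements by passing to I^{**}. For finitely presented X, Hom_S(X,
I)^{**} ≅ Hom_S(X, I^{**}), so I is (n,d)-injective iff I^{**} is; this is where n > d+1 enters
(`isNDInjective_iff_doubleDual`). -/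

/-! ### Vanishing of Ext along short exact sequences -/

section ExtVanishing

open Abelian

variable {A : Type u} [Ring A]

/-- The short complex of modules attached to two composable linear maps. -/
abbrev linearShortComplex {X Y Z : Type u} [AddCommGroup X] [AddCommGroup Y] [AddCommGroup Z]
    [Module A X] [Module A Y] [Module A Z] (i : X →ₗ[A] Y) (p : Y →ₗ[A] Z)
    (h : Function.Exact i p) : ShortComplex (ModuleCat.{u} A) :=
  ShortComplex.mk (ModuleCat.ofHom i) (ModuleCat.ofHom p)
    (ModuleCat.hom_ext (LinearMap.ext fun x => h.apply_apply_eq_zero x))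

theorem linearShortComplex_shortExact {X Y Z : Type u} [AddCommGroup X] [AddCommGroup Y]
    [AddCommGroup Z] [Module A X] [Module A Y] [Module A Z] {i : X →ₗ[A] Y} {p : Y →ₗ[A] Z}
    (hi : Function.Injective i) (h : Function.Exact i p) (hp : Function.Surjective p) :
    (linearShortComplex i p h).ShortExact where
  exact := (ShortComplex.ShortExact.moduleCat_exact_iff_function_exact _).2 h
  mono_f := (ModuleCat.mono_iff_injective _).2 hi
  epi_g := (ModuleCat.epi_iff_surjective _).2 hp

variable {X Y Z M M' : Type u} [AddCommGroup X] [AddCommGroup Y] [AddCommGroup Z]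
  [AddCommGroup M] [AddCommGroup M'] [Module A X] [Module A Y] [Module A Z] [Module A M]
  [Module A M']

theorem subsingleton_ext_congr (e : X ≃ₗ[A] Y) (e' : M ≃ₗ[A] M') (i : ℕ)
    (h : Subsingleton (ExtGroup A i X M)) : Subsingleton (ExtGroup A i Y M') := by
  refine ⟨fun a b => ?_⟩
  have key : ∀ a : ExtGroup A i Y M', a = 0 := fun a => by
    have h0 : ((Ext.mk₀ e.toModuleIso.hom).comp
        (a.comp (Ext.mk₀ e'.toModuleIso.inv) (add_zero i)) (zero_add i) : ExtGroup A i X M) = 0 :=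
      Subsingleton.elim _ _
    have h1 := congrArg (fun t => (Ext.mk₀ e.toModuleIso.inv).comp
        (t.comp (Ext.mk₀ e'.toModuleIso.hom) (add_zero i)) (zero_add i)) h0
    simpa [Ext.comp_assoc_of_third_deg_zero, Ext.mk₀_comp_mk₀_assoc, -LinearEquiv.toModuleIso_hom,
      -LinearEquiv.toModuleIso_inv] using h1
  rw [key a, key b]

section Sequence

variable {i : X →ₗ[A] Y} {p : Y →ₗ[A] Z}

theorem subsingleton_ext_left (hi : Function.Injective i) (h : Function.Exact i p)
    (hp : Function.Surjective p) (j : ℕ) (hY : Subsingleton (ExtGroup A j Y M))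
    (hZ : Subsingleton (ExtGroup A (j + 1) Z M)) : Subsingleton (ExtGroup A j X M) := by
  refine subsingleton_of_forall_eq 0 fun x => ?_
  obtain ⟨y, rfl⟩ := Ext.contravariant_sequence_exact₁
    (linearShortComplex_shortExact hi h hp) _ x (add_comm 1 j) (hZ.elim _ _)
  rw [hY.elim y 0, Ext.comp_zero]

theorem subsingleton_ext_middle (hi : Function.Injective i) (h : Function.Exact i p)
    (hp : Function.Surjective p) (j : ℕ) (hX : Subsingleton (ExtGroup A j X M))
    (hZ : Subsingleton (ExtGroup A j Z M)) : Subsingleton (ExtGroup A j Y M) := by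
  refine subsingleton_of_forall_eq 0 fun x => ?_
  obtain ⟨y, rfl⟩ := Ext.contravariant_sequence_exact₂
    (linearShortComplex_shortExact hi h hp) _ x (hX.elim _ _)
  rw [hZ.elim y 0, Ext.comp_zero]

theorem subsingleton_ext_right (hi : Function.Injective i) (h : Function.Exact i p)
    (hp : Function.Surjective p) (j : ℕ) (hX : Subsingleton (ExtGroup A j X M))
    (hY : Subsingleton (ExtGroup A (j + 1) Y M)) : Subsingleton (ExtGroup A (j + 1) Z M) := by
  refine subsingleton_of_forall_eq 0 fun x => ?_
  obtain ⟨y, rfl⟩ := Ext.contravariant_sequence_exact₃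
    (linearShortComplex_shortExact hi h hp) _ x (hY.elim _ _) (add_comm 1 j)
  rw [hX.elim y 0, Ext.comp_zero]

theorem exists_extension_of_subsingleton_ext_one (hi : Function.Injective i)
    (h : Function.Exact i p) (hp : Function.Surjective p)
    (hZ : Subsingleton (ExtGroup A 1 Z M)) (g : X →ₗ[A] M) : ∃ g' : Y →ₗ[A] M, g' ∘ₗ i = g := by
  obtain ⟨y, hy⟩ := Ext.contravariant_sequence_exact₁
    (linearShortComplex_shortExact hi h hp) _ (Ext.mk₀ (ModuleCat.ofHom g)) (add_zero 1)
    (hZ.elim _ _)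
  obtain ⟨y, rfl⟩ := (Ext.mk₀_bijective _ _).2 y
  refine ⟨y.hom, ?_⟩
  rw [Ext.mk₀_comp_mk₀] at hy
  exact congrArg ModuleCat.Hom.hom ((Ext.mk₀_bijective _ _).1 hy)

theorem subsingleton_ext_one_of_extension (hi : Function.Injective i)
    (h : Function.Exact i p) (hp : Function.Surjective p)
    (hY : Subsingleton (ExtGroup A 1 Y M))
    (H : ∀ g : X →ₗ[A] M, ∃ g' : Y →ₗ[A] M, g' ∘ₗ i = g) : Subsingleton (ExtGroup A 1 Z M) := by
  refine subsingleton_of_forall_eq 0 fun x => ?_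
  have hS := linearShortComplex_shortExact hi h hp
  obtain ⟨y, rfl⟩ := Ext.contravariant_sequence_exact₃ hS _ x (hY.elim _ _) (add_zero 1)
  obtain ⟨y, rfl⟩ := (Ext.mk₀_bijective _ _).2 y
  obtain ⟨g', hg'⟩ := H y.hom
  have : y = (linearShortComplex i p h).f ≫ ModuleCat.ofHom g' := ModuleCat.hom_ext hg'.symm
  -- The class x is now the extension class followed by i and then g', and the extension class
  -- followed by i is zero.
  rw [this, ← Ext.mk₀_comp_mk₀, hS.extClass_comp_assoc]

theorem subsingleton_ext_succ_of_projective [Module.Projective A X] (j : ℕ) :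
    Subsingleton (ExtGroup A (j + 1) X M) :=
  haveI : Projective (ModuleCat.of A X) := (IsProjective.iff_projective X).1 inferInstance
  Ext.subsingleton_of_projective _ _ _

end Sequence

theorem exact_single_zero_funLeft_succ (m : ℕ) :
    Function.Exact (LinearMap.single A (fun _ : Fin (m + 1) => X) 0)
      (LinearMap.funLeft A X Fin.succ) := by
  refine fun x => ⟨fun hx => ⟨x 0, ?_⟩, ?_⟩
  · ext k
    refine Fin.cases (by simp) (fun k => ?_) k
    simpa using (congrFun hx k).symm
  · rintro ⟨y, rfl⟩
    ext k
    simp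

theorem subsingleton_ext_pi (j : ℕ) (h : Subsingleton (ExtGroup A (j + 1) X M)) (m : ℕ) :
    Subsingleton (ExtGroup A (j + 1) (Fin m → X) M) := by
  induction m with
  | zero => exact subsingleton_ext_succ_of_projective j
  | succ m ih =>
    exact subsingleton_ext_middle (Pi.single_injective (M := fun _ : Fin (m + 1) => X) 0)
      (exact_single_zero_funLeft_succ m) (fun y => ⟨Fin.cons 0 y, rfl⟩) _ h ih

end ExtVanishing

/-! ### Finite presentations of length n, recursively -/

section FinitePresentation

theorem linearMap_pi_apply {S : Type u} [Ring S] {N : Type*} [AddCommGroup N] [Module S N] {m : ℕ}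
    (f : (Fin m → S) →ₗ[S] N) (a : Fin m → S) : f a = ∑ j, a j • f (Pi.single j 1) := by
  rw [LinearMap.pi_apply_eq_sum_univ f a]
  refine Finset.sum_congr rfl fun j _ => ?_
  congr! 2
  ext k
  simp [Pi.single_apply, eq_comm]

/-- A module with a length `n` presentation by finitely generated free modules, described
recursively. -/
def IsFP (A : Type u) [Ring A] : ℕ → ∀ (U : Type u) [AddCommGroup U] [Module A U], Prop
  | 0, U, _, _ => Module.Finite A U
  | n + 1, U, _, _ => ∃ (m : ℕ) (f : (Fin m → A) →ₗ[A] U), Function.Surjective f ∧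
      IsFP A n (LinearMap.ker f)

variable {A : Type u} [Ring A]

/-- The semilinear form also covers the identification of a ring with its double opposite. -/
theorem IsFP.of_ringEquiv {B : Type u} [Ring B] (σ : A ≃+* B) {n : ℕ} {U V : Type u}
    [AddCommGroup U] [Module A U] [AddCommGroup V] [Module B V] (e : U ≃+ V)
    (he : ∀ (a : A) (x : U), e (a • x) = σ a • e x) (h : IsFP A n U) : IsFP B n V := by
  induction n generalizing U V with
  | zero =>
    have : Module.Finite A U := h
    obtain ⟨m, f, hf⟩ := Module.Finite.exists_fin' A U
    refine Module.Finite.of_surjective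
      (Fintype.linearCombination B fun j => e (f (Pi.single j 1))) fun v => ?_
    obtain ⟨x, hx⟩ := hf (e.symm v)
    refine ⟨fun j => σ (x j), ?_⟩
    rw [← e.apply_symm_apply v, ← hx, Fintype.linearCombination_apply, linearMap_pi_apply f x,
      map_sum]
    exact Finset.sum_congr rfl fun j _ => (he _ _).symm
  | succ n ih =>
    obtain ⟨m, f, hf, hk⟩ := h
    let g : (Fin m → B) →ₗ[B] V :=
      { toFun := fun x => e (f fun j => σ.symm (x j))
        map_add' := fun x y => by
          rw [← map_add, ← map_add]
          congr 2
          ext j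
          simp
        map_smul' := fun b x => by
          rw [RingHom.id_apply, ← σ.apply_symm_apply b, ← he, ← map_smul]
          congr 2
          ext j
          simp }
    have hg : ∀ x, g x = e (f fun j => σ.symm (x j)) := fun _ => rfl
    refine ⟨m, g, fun v => ?_, ih (U := LinearMap.ker f) (V := LinearMap.ker g) ?_ ?_ hk⟩
    · obtain ⟨x, hx⟩ := hf (e.symm v)
      exact ⟨fun j => σ (x j), by simp [hg, hx]⟩
    · exact
        { toFun := fun x => ⟨fun j => σ (x.1 j), by simp [hg]⟩
          invFun := fun x => ⟨fun j => σ.symm (x.1 j), e.injective ((map_zero e).symm ▸ x.2)⟩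
          left_inv := fun x => by ext; simp
          right_inv := fun x => by ext; simp
          map_add' := fun x y => by ext; simp }
    · intro a x
      ext j
      exact map_mul σ _ _

variable {U X Y Z : Type u} [AddCommGroup U] [Module A U] [AddCommGroup X] [Module A X]
  [AddCommGroup Y] [Module A Y] [AddCommGroup Z] [Module A Z]

theorem IsFP.congr {n : ℕ} (e : X ≃ₗ[A] Y) (h : IsFP A n X) : IsFP A n Y :=
  h.of_ringEquiv (RingEquiv.refl A) e.toAddEquiv fun a x => e.map_smul a x

theorem exists_pi_fin_cover {F : Type u} [AddCommGroup F] [Module A F] [Module.Free A F]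
    [Module.Finite A F] (f : F →ₗ[A] U) (hf : Function.Surjective f) :
    ∃ (m : ℕ) (g : (Fin m → A) →ₗ[A] U), Function.Surjective g ∧
      Nonempty (LinearMap.ker f ≃ₗ[A] LinearMap.ker g) := by
  let b := (Module.Free.chooseBasis A F).reindex (Fintype.equivFin _)
  let e := b.equivFun
  refine ⟨_, f ∘ₗ e.symm.toLinearMap, hf.comp e.symm.surjective,
    ⟨(e.submoduleMap (LinearMap.ker f)).trans (LinearEquiv.ofEq _ _ ?_)⟩⟩
  ext x
  simp [Submodule.mem_map_equiv]

theorem IsFP.of_surjective {n : ℕ} {F : Type u} [AddCommGroup F] [Module A F] [Module.Free A F]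
    [Module.Finite A F] (f : F →ₗ[A] U) (hf : Function.Surjective f)
    (hk : IsFP A n (LinearMap.ker f)) : IsFP A (n + 1) U := by
  obtain ⟨m, g, hg, ⟨e⟩⟩ := exists_pi_fin_cover f hf
  exact ⟨m, g, hg, hk.congr e⟩

theorem IsFP.of_succ {n : ℕ} (h : IsFP A (n + 1) U) : IsFP A n U := by
  induction n generalizing U with
  | zero =>
    obtain ⟨m, f, hf, -⟩ := h
    exact Module.Finite.of_surjective f hf
  | succ n ih =>
    obtain ⟨m, f, hf, hk⟩ := h
    exact ⟨m, f, hf, ih hk⟩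

theorem IsFP.of_le {n k : ℕ} (hnk : k ≤ n) (h : IsFP A n U) : IsFP A k U := by
  induction n, hnk using Nat.le_induction with
  | base => exact h
  | succ n _ ih => exact ih h.of_succ

theorem IsFP.of_subsingleton (n : ℕ) [Subsingleton U] : IsFP A n U := by
  induction n generalizing U with
  | zero => exact (inferInstance : Module.Finite A U)
  | succ n ih => exact ⟨0, 0, fun x => ⟨0, Subsingleton.elim _ _⟩, ih⟩

theorem IsFP.pi_fin (n m : ℕ) : IsFP A n (Fin m → A) := by
  cases n with
  | zero => exact (inferInstance : Module.Finite A (Fin m → A))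
  | succ n =>
    refine ⟨m, LinearMap.id, Function.surjective_id, ?_⟩
    rw [LinearMap.ker_id]
    exact IsFP.of_subsingleton n

/-- Horseshoe argument: lifting the cover of Z through p and adding the cover of X gives a cover of
Y whose kernel is an extension of the two kernels. -/
theorem IsFP.middle {n : ℕ} {i : X →ₗ[A] Y} {p : Y →ₗ[A] Z} (hi : Function.Injective i)
    (h : Function.Exact i p) (hp : Function.Surjective p) (hX : IsFP A n X) (hZ : IsFP A n Z) :
    IsFP A n Y := by
  induction n generalizing X Y Z with
  | zero =>
    have : Module.Finite A X := hX
    have : Module.Finite A Z := hZ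
    exact Module.Finite.of_exact h hp
  | succ n ih =>
    obtain ⟨a, f, hf, hkf⟩ := hX
    obtain ⟨c, g, hg, hkg⟩ := hZ
    obtain ⟨l, hl⟩ := Module.projective_lifting_property p g hp
    have hl' : ∀ z, p (l z) = g z := fun z => LinearMap.congr_fun hl z
    let q : ((Fin a → A) × (Fin c → A)) →ₗ[A] Y := (i ∘ₗ f).coprod l
    have hq : ∀ x, q x = i (f x.1) + l x.2 := fun x => rfl
    have hpq : ∀ x, p (q x) = g x.2 := fun x => by
      rw [hq, map_add, hl', h.apply_apply_eq_zero, zero_add]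
    refine IsFP.of_surjective q (fun y => ?_) ?_
    · obtain ⟨z, hz⟩ := hg (p y)
      obtain ⟨x, hx⟩ := (h (y - l z)).1 (by rw [map_sub, hl', hz, sub_self])
      obtain ⟨w, rfl⟩ := hf x
      exact ⟨(w, z), by rw [hq, hx, sub_add_cancel]⟩
    · let j : LinearMap.ker f →ₗ[A] LinearMap.ker q :=
        (LinearMap.inl A (Fin a → A) (Fin c → A)).restrict fun x hx => by
          rw [LinearMap.mem_ker] at hx ⊢
          simp [hq, hx]
      let r : LinearMap.ker q →ₗ[A] LinearMap.ker g :=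
        (LinearMap.snd A (Fin a → A) (Fin c → A)).restrict fun x hx => by
          rw [LinearMap.mem_ker] at hx ⊢
          rw [LinearMap.snd_apply, ← hpq, hx, map_zero]
      refine ih (i := j) (p := r) (fun x y hxy => ?_) (fun x => ⟨fun hx => ?_, ?_⟩) (fun z => ?_)
        hkf hkg
      · exact Subtype.ext (congrArg (fun t => t.1.1) hxy)
      · have h2 : x.1.2 = 0 := congrArg Subtype.val hx
        have h1 : f x.1.1 = 0 := hi (by
          have := x.2
          rw [LinearMap.mem_ker, hq, h2, map_zero, add_zero] at this
          rw [this, map_zero])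
        exact ⟨⟨x.1.1, h1⟩, Subtype.ext (Prod.ext rfl h2.symm)⟩
      · rintro ⟨y, rfl⟩
        rfl
      · obtain ⟨x, hx⟩ := (h (l z.1)).1 (by rw [hl']; exact z.2)
        obtain ⟨w, rfl⟩ := hf x
        -- Here i (f w) = l z, so the first coordinate must be -w to cancel the lift.
        exact ⟨⟨(-w, z.1), by
          rw [LinearMap.mem_ker, hq, map_neg, map_neg, hx, neg_add_cancel]⟩, rfl⟩

/-- The kernel of the composite cover of Z is an extension of X by the kernel of the cover of Y. -/
theorem IsFP.right {n : ℕ} {i : X →ₗ[A] Y} {p : Y →ₗ[A] Z} (hi : Function.Injective i)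
    (h : Function.Exact i p) (hp : Function.Surjective p) (hX : IsFP A n X)
    (hY : IsFP A (n + 1) Y) : IsFP A (n + 1) Z := by
  obtain ⟨m, f, hf, hk⟩ := hY
  refine ⟨m, p ∘ₗ f, hp.comp hf, ?_⟩
  have hr : ∀ x : LinearMap.ker (p ∘ₗ f), f x.1 ∈ LinearMap.range i := fun x => (h (f x.1)).1 x.2
  let r : LinearMap.ker (p ∘ₗ f) →ₗ[A] LinearMap.range i :=
    (f ∘ₗ (LinearMap.ker (p ∘ₗ f)).subtype).codRestrict _ hr
  refine IsFP.middle (i := Submodule.inclusion (LinearMap.ker_le_ker_comp f p)) (p := r)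
    (Submodule.inclusion_injective _) (fun x => ⟨fun hx => ?_, ?_⟩) (fun y => ?_) hk
    (hX.congr (LinearEquiv.ofInjective i hi))
  · exact ⟨⟨x.1, congrArg Subtype.val hx⟩, rfl⟩
  · rintro ⟨y, rfl⟩
    exact Subtype.ext y.2
  · obtain ⟨y, x, rfl⟩ := y
    obtain ⟨w, hw⟩ := hf (i x)
    exact ⟨⟨w, by simp [hw, h.apply_apply_eq_zero]⟩, Subtype.ext hw⟩

theorem IsFP.pi {n : ℕ} (h : IsFP A n X) (m : ℕ) : IsFP A n (Fin m → X) := by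
  induction m with
  | zero => exact IsFP.of_subsingleton n
  | succ m ih =>
    exact IsFP.middle (i := LinearMap.single A (fun _ : Fin (m + 1) => X) 0)
      (Pi.single_injective (M := fun _ : Fin (m + 1) => X) 0)
      (exact_single_zero_funLeft_succ m) (fun y => ⟨Fin.cons 0 y, rfl⟩) h ih

end FinitePresentation

/-! ### Comparison of free presentations with the recursive condition -/

section FreePresentation

variable {A : Type u} [Ring A] {U : Type u} [AddCommGroup U] [Module A U]

/-- Removing the degree `0` term of a free presentation gives a presentation of the kernel. -/
def FreePresentation.shift {n n' : ℕ∞} (hn : ∀ i : ℕ, (i : ℕ∞) ≤ n' → ((i + 1 : ℕ) : ℕ∞) ≤ n)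
    (P : FreePresentation A n U) : FreePresentation A n' (LinearMap.ker P.ε) where
  F i := P.F (i + 1)
  d i := P.d (i + 1)
  ε := (P.d 0).codRestrict _ fun x =>
    (P.exact_zero (hn 0 (zero_le))).apply_apply_eq_zero x
  free i hi := P.free (i + 1) (hn i hi)
  finite i hi := P.finite (i + 1) (hn i hi)
  surjective x := by
    obtain ⟨y, hy⟩ := (P.exact_zero (hn 0 (zero_le)) x.1).1 x.2
    exact ⟨y, Subtype.ext hy⟩
  exact_zero h1 x := by
    rw [← P.exact_succ 0 (hn 1 h1) x, Subtype.ext_iff]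
    rfl
  exact_succ i hi := P.exact_succ (i + 1) (hn (i + 2) hi)

/-- The recursive form lets later inductions peel off one free cover at a time. -/
theorem IsFinitelyNPresented.isFP {n : ℕ} (h : IsFinitelyNPresented A n U) : IsFP A n U := by
  induction n generalizing U with
  | zero =>
    obtain ⟨P⟩ := h
    have := P.finite 0 le_rfl
    exact Module.Finite.of_surjective P.ε P.surjective
  | succ n ih =>
    obtain ⟨P⟩ := h
    have := P.finite 0 (zero_le)
    have := P.free 0 (zero_le)
    exact IsFP.of_surjective P.ε P.surjective
      (ih ⟨P.shift fun i hi => by exact_mod_cast Nat.succ_le_succ (by exact_mod_cast hi)⟩)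

/-- Splicing a presentation of the kernel of `f : F → U` with `f`. -/
def FreePresentation.cons {n : ℕ} {F : Type u} [AddCommGroup F] [Module A F] [Module.Free A F]
    [Module.Finite A F] (f : F →ₗ[A] U) (hf : Function.Surjective f)
    (P : FreePresentation A n (LinearMap.ker f)) : FreePresentation A (n + 1 : ℕ) U where
  F i := Nat.casesOn i (ModuleCat.of A F) P.F
  d i := match i with
    | 0 => (LinearMap.ker f).subtype ∘ₗ P.ε
    | i + 1 => P.d i
  ε := f
  free i hi := match i with
    | 0 => inferInstanceAs (Module.Free A F)
    | i + 1 => P.free i (by exact_mod_cast Nat.le_of_succ_le_succ (by exact_mod_cast hi))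
  finite i hi := match i with
    | 0 => inferInstanceAs (Module.Finite A F)
    | i + 1 => P.finite i (by exact_mod_cast Nat.le_of_succ_le_succ (by exact_mod_cast hi))
  surjective := hf
  exact_zero _ x := by
    refine ⟨fun hx => ?_, ?_⟩
    · obtain ⟨y, hy⟩ := P.surjective ⟨x, hx⟩
      exact ⟨y, congrArg Subtype.val hy⟩
    · rintro ⟨y, rfl⟩
      exact (P.ε y).2
  exact_succ i hi := match i with
    | 0 => fun x => by
      rw [← P.exact_zero (by exact_mod_cast Nat.le_of_succ_le_succ (by exact_mod_cast hi)) x,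
        Subtype.ext_iff]
      rfl
    | i + 1 => P.exact_succ i (by exact_mod_cast Nat.le_of_succ_le_succ (by exact_mod_cast hi))

theorem IsFP.isFinitelyNPresented {n : ℕ} (h : IsFP A n U) : IsFinitelyNPresented A n U := by
  induction n generalizing U with
  | zero =>
    have : Module.Finite A U := h
    obtain ⟨m, f, hf⟩ := Module.Finite.exists_fin' A U
    -- For length 0 both exactness conditions are vacuous, so the terms above degree 0 and the zero
    -- differentials are fillers.
    exact ⟨{ F := fun _ => ModuleCat.of A (Fin m → A)
             d := fun _ => 0
             ε := f
             free := fun _ _ => inferInstanceAs (Module.Free A (Fin m → A))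
             finite := fun _ _ => inferInstanceAs (Module.Finite A (Fin m → A))
             surjective := hf
             exact_zero := fun h => absurd h (by simp)
             exact_succ := fun i h => absurd h (by simp) }⟩
  | succ n ih =>
    obtain ⟨m, f, hf, hk⟩ := h
    obtain ⟨P⟩ := ih hk
    exact ⟨P.cons f hf⟩

end FreePresentation

/-! ### Change of rings along an isomorphism -/

section RingEquiv

/-- Restriction of scalars along σ is an equivalence, hence bijective on Ext, and it preserves
finite presentations. -/
theorem IsNDInjective.of_ringEquiv {A B : Type u} [Ring A] [Ring B] (σ : A ≃+* B) {n d : ℕ}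
    {M M' : Type u} [AddCommGroup M] [Module A M] [AddCommGroup M'] [Module B M'] (e : M ≃+ M')
    (he : ∀ (a : A) (x : M), e (a • x) = σ a • e x) (h : IsNDInjective A n d M) :
    IsNDInjective B n d M' := by
  intro U _ _ hU
  let F : ModuleCat.{u} B ⥤ ModuleCat.{u} A :=
    (ModuleCat.restrictScalarsEquivalenceOfRingEquiv σ).functor
  have : F.PreservesProjectiveObjects := inferInstance
  have hF := F.mapExt_bijective_of_preservesProjectiveObjects (ModuleCat.of B U)
    (ModuleCat.of B M') (d + 1)
  have smul_def : ∀ (X : ModuleCat.{u} B) (a : A) (x : F.obj X),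
      a • x = (σ a • (show X from x) : X) := fun _ _ _ => rfl
  have hFP : IsFP A n (F.obj (ModuleCat.of B U)) :=
    hU.isFP.of_ringEquiv σ.symm
      (show U ≃+ F.obj (ModuleCat.of B U) from AddEquiv.refl U) fun b x => by
        refine Eq.symm ((smul_def (ModuleCat.of B U) _ _).trans ?_)
        rw [σ.apply_symm_apply]
        rfl
  have hExt := h (F.obj (ModuleCat.of B U)) hFP.isFinitelyNPresented
  have e' : M ≃ₗ[A] F.obj (ModuleCat.of B M') := { e with map_smul' := he }
  have := subsingleton_ext_congr (LinearEquiv.refl A _) e' _ hExt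
  exact hF.1.subsingleton

end RingEquiv

/-! ### Extending and separating characters -/

namespace CharacterModule

section Extension

variable {X Y Z : Type*} [AddCommGroup X] [AddCommGroup Y] [AddCommGroup Z]

/-- The character descends to X / ker f, which embeds in Y, and ℚ/ℤ is injective. -/
theorem exists_comp_eq (f : X →+ Y) (c : CharacterModule X) (h : ∀ x, f x = 0 → c x = 0) :
    ∃ c' : CharacterModule Y, ∀ x, c' (f x) = c x := by
  let g : X ⧸ f.ker →+ AddCircle (1 : ℚ) :=
    QuotientAddGroup.lift f.ker (show X →+ AddCircle (1 : ℚ) from c) fun x hx => h x hx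
  obtain ⟨c', hc'⟩ := dual_surjective_of_injective (QuotientAddGroup.kerLift f).toIntLinearMap
    (QuotientAddGroup.kerLift_injective f) g
  exact ⟨c', fun x => DFunLike.congr_fun hc' (QuotientAddGroup.mk x)⟩

theorem exists_apply_ne_zero_of_notMem {H : AddSubgroup X} {x : X} (hx : x ∉ H) :
    ∃ c : CharacterModule X, (∀ y ∈ H, c y = 0) ∧ c x ≠ 0 := by
  obtain ⟨c, hc⟩ := exists_character_apply_ne_zero_of_ne_zero
    (fun h => hx ((QuotientAddGroup.eq_zero_iff x).1 h) : (QuotientAddGroup.mk x : X ⧸ H) ≠ 0)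
  refine ⟨AddMonoidHom.comp (show X ⧸ H →+ AddCircle (1 : ℚ) from c) (QuotientAddGroup.mk' H),
    fun y hy => ?_, hc⟩
  exact (congrArg c ((QuotientAddGroup.eq_zero_iff y).2 hy)).trans (map_zero c)

/-- If y in ker g were outside the image of f, some character would kill that image but not y; it
could not factor through g. The other direction is extension of characters. -/
theorem exact_iff_forall_exists (f : X →+ Y) (g : Y →+ Z) (hfg : ∀ x, g (f x) = 0) :
    Function.Exact f g ↔ ∀ c : CharacterModule Y, (∀ x, c (f x) = 0) →
      ∃ c' : CharacterModule Z, ∀ y, c' (g y) = c y := by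
  refine ⟨fun h c hc => exists_comp_eq g c fun y hy => ?_, fun H y => ⟨fun hy => ?_, ?_⟩⟩
  · obtain ⟨x, rfl⟩ := (h y).1 hy
    exact hc x
  · by_contra hn
    obtain ⟨c, hc, hcy⟩ := exists_apply_ne_zero_of_notMem (H := f.range) hn
    obtain ⟨c', hc'⟩ := H c fun x => hc _ ⟨x, rfl⟩
    exact hcy (by rw [← hc', hy, map_zero])
  · rintro ⟨x, rfl⟩
    exact hfg x

end Extension

end CharacterModule

/-! ### Balanced tensor products and the character adjunction -/

namespace BalancedTensor

section Lift

variable (S R : Type*) [Ring S] [Ring R] {A B T : Type*} [AddCommGroup A]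
  [AddCommGroup B] [AddCommGroup T] [Module S A] [Module Rᵐᵒᵖ A] [SMulCommClass S Rᵐᵒᵖ A]
  [Module R B]

/-- The pure tensor `a ⊗ b` in `A ⊗_R B`. -/
def tmul (a : A) (b : B) : BalancedTensor S R A B :=
  Submodule.Quotient.mk (a ⊗ₜ[ℤ] b)

variable {S R}

theorem tmul_add (a : A) (b b' : B) : tmul S R a (b + b') = tmul S R a b + tmul S R a b' := by
  simp [tmul, TensorProduct.tmul_add]

theorem add_tmul (a a' : A) (b : B) : tmul S R (a + a') b = tmul S R a b + tmul S R a' b := by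
  simp [tmul, TensorProduct.add_tmul]

theorem op_smul_tmul (r : R) (a : A) (b : B) : tmul S R (op r • a) b = tmul S R a (r • b) :=
  (Submodule.Quotient.eq _).2 (Submodule.subset_span ⟨a, r, b, rfl⟩)

theorem induction_on {p : BalancedTensor S R A B → Prop} (t : BalancedTensor S R A B)
    (zero : p 0) (tmul : ∀ a b, p (tmul S R a b)) (add : ∀ x y, p x → p y → p (x + y)) : p t := by
  induction t using Submodule.Quotient.induction_on with
  | _ t =>
    induction t using TensorProduct.induction_on with
    | zero => exact zero
    | tmul a b => exact tmul a b
    | add x y hx hy => exact add _ _ hx hy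

/-- The homomorphism out of `A ⊗_R B` given by a balanced biadditive map. -/
noncomputable def lift (f : A →+ B →+ T) (hf : ∀ a (r : R) b, f (op r • a) b = f a (r • b)) :
    BalancedTensor S R A B →+ T :=
  QuotientAddGroup.lift (balancedRelations S R A B).toAddSubgroup
    (TensorProduct.liftAddHom f fun n a b => by simp) fun x hx => by
      set F : A ⊗[ℤ] B →+ T := TensorProduct.liftAddHom f fun n a b => by simp
      -- The relations form an S-span while F is only additive, so the induction carries an
      -- arbitrary scalar; a scalar times a generator is again a generator since the actions
      -- commute.
      have key : ∀ s : S, F (s • x) = 0 := by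
        refine Submodule.span_induction ?_ ?_ ?_ ?_ hx
        · rintro _ ⟨a, r, b, rfl⟩ s
          rw [smul_sub, map_sub, TensorProduct.smul_tmul', TensorProduct.smul_tmul', smul_comm]
          exact sub_eq_zero.2 (hf _ _ _)
        · intro s
          rw [smul_zero, map_zero]
        · intro x y _ _ hx hy s
          rw [smul_add, map_add, hx, hy, add_zero]
        · intro s x _ hx s'
          rw [smul_smul, hx]
      simpa using key 1

/-- The adjunction `(A ⊗_R B)^* ≃ Hom_{Rᵐᵒᵖ}(A, B^*)`. -/
noncomputable def characterEquiv :
    CharacterModule (BalancedTensor S R A B) ≃+ (A →ₗ[Rᵐᵒᵖ] CharacterModule B) where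
  toFun c :=
    { toFun := fun a => AddMonoidHom.mk' (fun b => c (tmul S R a b))
        fun b b' => by rw [tmul_add, map_add]
      map_add' := fun a a' => CharacterModule.ext _ fun b =>
        (congrArg c (add_tmul a a' b)).trans (map_add c _ _)
      map_smul' := fun r a => CharacterModule.ext _ fun b => congrArg c (op_smul_tmul r.unop a b) }
  invFun φ := lift (T := AddCircle (1 : ℚ))
    (show A →+ B →+ AddCircle (1 : ℚ) from φ.toAddMonoidHom)
    fun a r b => DFunLike.congr_fun (φ.map_smul (op r) a) b
  left_inv c := CharacterModule.ext _ fun t => by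
    induction t using induction_on with
    | zero => rw [map_zero]; exact map_zero _
    | tmul a b => rfl
    | add x y hx hy => rw [map_add, ← hx, ← hy]; exact map_add _ _ _
  right_inv φ := rfl
  map_add' c c' := rfl

end Lift

end BalancedTensor

/-! ### Tor, Ext and the dual module -/

section Duality

variable {A : Type u} [Ring A]

theorem subsingleton_tor_iff_exact {U : Type u} [AddCommGroup U] [Module Aᵐᵒᵖ U] {N : Type u}
    [AddCommGroup N] [Module A N] (P : ProjectiveResolution (ModuleCat.of Aᵐᵒᵖ U)) (i : ℕ) :
    Subsingleton (TorGroup A (i + 1) U N) ↔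
      Function.Exact (BalancedTensor.map A N (P.complex.d (i + 2) (i + 1)).hom)
        (BalancedTensor.map A N (P.complex.d (i + 1) i).hom) := by
  rw [← ModuleCat.isZero_iff_subsingleton]
  refine (P.isoLeftDerivedObj (tensorFunctor A N) (i + 1)).isZero_iff.trans ?_
  refine (HomologicalComplex.exactAt_iff_isZero_homology _ _).symm.trans ?_
  rw [HomologicalComplex.exactAt_iff' _ (i + 2) (i + 1) i (by simp) (by simp)]
  exact ShortComplex.ShortExact.moduleCat_exact_iff_function_exact _

theorem subsingleton_ext_iff_forall_exists {U : Type u} [AddCommGroup U] [Module A U] {M : Type u}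
    [AddCommGroup M] [Module A M] (P : ProjectiveResolution (ModuleCat.of A U)) (i : ℕ) :
    Subsingleton (ExtGroup A (i + 1) U M) ↔
      ∀ f : P.complex.X (i + 1) →ₗ[A] M, (f ∘ₗ (P.complex.d (i + 2) (i + 1)).hom = 0) →
        ∃ g : P.complex.X i →ₗ[A] M, g ∘ₗ (P.complex.d (i + 1) i).hom = f := by
  constructor
  · intro h f hf
    have hf' : P.complex.d (i + 2) (i + 1) ≫ ModuleCat.ofHom f = 0 := ModuleCat.hom_ext hf
    obtain ⟨g, hg⟩ := (P.extMk_eq_zero_iff (ModuleCat.ofHom f) (i + 2) rfl hf' i rfl).1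
      (h.elim _ _)
    exact ⟨g.hom, congrArg ModuleCat.Hom.hom hg⟩
  · intro h
    refine subsingleton_of_forall_eq 0 fun x => ?_
    obtain ⟨f, hf, rfl⟩ := P.extMk_surjective x (i + 2) rfl
    obtain ⟨g, hg⟩ := h f.hom (congrArg ModuleCat.Hom.hom hf)
    exact (P.extMk_eq_zero_iff f (i + 2) rfl hf i rfl).2 ⟨ModuleCat.ofHom g, ModuleCat.hom_ext hg⟩

/-- For one projective resolution P of U, the dual of the complex P ⊗ N is the complex Hom(P, N^*),
and exactness can be tested after dualizing. -/
theorem subsingleton_tor_iff_subsingleton_ext {U : Type u} [AddCommGroup U] [Module Aᵐᵒᵖ U]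
    {N : Type u} [AddCommGroup N] [Module A N] (i : ℕ) :
    Subsingleton (TorGroup A (i + 1) U N) ↔
      Subsingleton (ExtGroup Aᵐᵒᵖ (i + 1) U (CharacterModule N)) := by
  let P := projectiveResolution (ModuleCat.of Aᵐᵒᵖ U)
  rw [subsingleton_tor_iff_exact P, subsingleton_ext_iff_forall_exists P]
  have hd : ∀ x, (P.complex.d (i + 1) i).hom ((P.complex.d (i + 2) (i + 1)).hom x) = 0 := fun x =>
    LinearMap.congr_fun (congrArg ModuleCat.Hom.hom (P.complex.d_comp_d (i + 2) (i + 1) i)) x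
  have key := CharacterModule.exact_iff_forall_exists
    (BalancedTensor.map A N (P.complex.d (i + 2) (i + 1)).hom).toAddMonoidHom
    (BalancedTensor.map A N (P.complex.d (i + 1) i).hom).toAddMonoidHom fun t => by
      induction t using BalancedTensor.induction_on with
      | zero => rw [map_zero, map_zero]
      | tmul a b =>
        change BalancedTensor.tmul ℤ A ((P.complex.d (i + 1) i).hom
          ((P.complex.d (i + 2) (i + 1)).hom a)) b = 0
        rw [hd]
        exact map_zero (AddMonoidHom.mk' (fun a => BalancedTensor.tmul ℤ A a b) fun a a' =>
          BalancedTensor.add_tmul a a' b)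
      | add x y hx hy => rw [map_add, map_add, hx, hy, add_zero]
  refine key.trans ?_
  refine BalancedTensor.characterEquiv.toEquiv.forall_congr fun c => ?_
  have h1 : (∀ x, c (BalancedTensor.map A N (P.complex.d (i + 2) (i + 1)).hom x) = 0) ↔
      BalancedTensor.characterEquiv c ∘ₗ (P.complex.d (i + 2) (i + 1)).hom = 0 := by
    refine ⟨fun h => LinearMap.ext fun a => CharacterModule.ext _ fun b =>
      h (BalancedTensor.tmul ℤ A a b), fun h x => ?_⟩
    induction x using BalancedTensor.induction_on with
    | zero => rw [map_zero, map_zero]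
    | tmul a b => exact DFunLike.congr_fun (LinearMap.congr_fun h a) b
    | add x y hx hy => rw [map_add, map_add, hx, hy, add_zero]
  refine imp_congr h1 ?_
  refine BalancedTensor.characterEquiv.toEquiv.exists_congr fun c' => ?_
  refine ⟨fun h => LinearMap.ext fun a => CharacterModule.ext _ fun b =>
    h (BalancedTensor.tmul ℤ A a b), fun h x => ?_⟩
  induction x using BalancedTensor.induction_on with
  | zero => rw [map_zero, map_zero, map_zero]
  | tmul a b => exact DFunLike.congr_fun (LinearMap.congr_fun h a) b
  | add x y hx hy => rw [map_add, map_add, map_add, hx, hy]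

theorem isNDFlat_iff_isNDInjective_characterModule {n d : ℕ} {N : Type u} [AddCommGroup N]
    [Module A N] : IsNDFlat A n d N ↔ IsNDInjective Aᵐᵒᵖ n d (CharacterModule N) :=
  forall_congr' fun _ => forall_congr' fun _ => forall_congr' fun _ => imp_congr_right fun _ =>
    subsingleton_tor_iff_subsingleton_ext d

end Duality

/-! ### Finite presentations and characters of Hom -/

section Presentation

/-- A presentation of `K` by generators `gen j` and relations `∑ j, rel i j • gen j = 0`. -/
structure MatrixPresentation (S : Type u) [Ring S] (K : Type u) [AddCommGroup K]
    [Module S K] where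
  m : ℕ
  l : ℕ
  gen : Fin m → K
  rel : Fin l → Fin m → S
  exists_sum_eq : ∀ x : K, ∃ a : Fin m → S, ∑ j, a j • gen j = x
  sum_rel : ∀ i, ∑ j, rel i j • gen j = 0
  exists_rel : ∀ a : Fin m → S, ∑ j, a j • gen j = 0 →
    ∃ b : Fin l → S, ∀ j, a j = ∑ i, b i * rel i j

variable {S : Type u} [Ring S] {K : Type u} [AddCommGroup K] [Module S K]

/-- The presentation given by free covers of `K` and of the kernel of the first cover. -/
def MatrixPresentation.ofSurjective {m l : ℕ} (f : (Fin m → S) →ₗ[S] K)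
    (hf : Function.Surjective f) (g : (Fin l → S) →ₗ[S] LinearMap.ker f)
    (hg : Function.Surjective g) : MatrixPresentation S K where
  m := m
  l := l
  gen j := f (Pi.single j 1)
  rel i := (g (Pi.single i 1)).1
  exists_sum_eq x := by
    obtain ⟨a, rfl⟩ := hf x
    exact ⟨a, (linearMap_pi_apply f a).symm⟩
  sum_rel i := (linearMap_pi_apply f _).symm.trans (g (Pi.single i 1)).2
  exists_rel a ha := by
    obtain ⟨b, hb⟩ := hg ⟨a, (linearMap_pi_apply f a).trans ha⟩
    refine ⟨b, fun j => ?_⟩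
    rw [linearMap_pi_apply g b] at hb
    simpa using (congrFun (congrArg Subtype.val hb) j).symm

theorem IsFP.nonempty_matrixPresentation (h : IsFP S 1 K) :
    Nonempty (MatrixPresentation S K) := by
  obtain ⟨m, f, hf, hk⟩ := h
  have : Module.Finite S (LinearMap.ker f) := hk
  obtain ⟨l, g, hg⟩ := Module.Finite.exists_fin' S (LinearMap.ker f)
  exact ⟨.ofSurjective f hf g hg⟩

/-- The character `φ ↦ f (φ x)` of `Hom_S(K, N)`. -/
def evalCharacter {N : Type*} [AddCommGroup N] [Module S N] (f : CharacterModule N) (x : K) :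
    CharacterModule (K →ₗ[S] N) :=
  AddMonoidHom.mk' (fun φ => f (φ x)) fun _ _ => map_add f _ _

section evalCharacter

variable {N : Type*} [AddCommGroup N] [Module S N]

theorem evalCharacter_apply (f : CharacterModule N) (x : K) (φ : K →ₗ[S] N) :
    evalCharacter f x φ = f (φ x) :=
  rfl

theorem evalCharacter_add_left (f g : CharacterModule N) (x : K) :
    evalCharacter (S := S) (f + g) x = evalCharacter f x + evalCharacter g x :=
  rfl

theorem evalCharacter_add (f : CharacterModule N) (x y : K) :
    evalCharacter (S := S) f (x + y) = evalCharacter f x + evalCharacter f y :=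
  CharacterModule.ext _ fun φ => (congrArg f (map_add φ x y)).trans (map_add f _ _)

theorem evalCharacter_smul (f : CharacterModule N) (s : S) (x : K) :
    evalCharacter f (s • x) = evalCharacter (S := S) (op s • f) x :=
  CharacterModule.ext _ fun φ => congrArg f (map_smul φ s x)

theorem evalCharacter_sum {ι : Type*} (t : Finset ι) (f : CharacterModule N) (x : ι → K) :
    evalCharacter (S := S) f (∑ j ∈ t, x j) = ∑ j ∈ t, evalCharacter f (x j) :=
  map_sum (AddMonoidHom.mk' (fun x => evalCharacter (S := S) f x) (evalCharacter_add f)) x t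

end evalCharacter

theorem CharacterModule.sum_apply {X ι : Type*} [AddCommGroup X] (t : Finset ι)
    (f : ι → CharacterModule X) (x : X) : (∑ i ∈ t, f i) x = ∑ i ∈ t, f i x :=
  AddMonoidHom.finsetSum_apply (M := X) (N := AddCircle (1 : ℚ)) f t x

theorem CharacterModule.pi_apply {N : Type*} [AddCommGroup N] {m : ℕ}
    (c : CharacterModule (Fin m → N)) (x : Fin m → N) : c x = ∑ j, c (Pi.single j (x j)) := by
  conv_lhs => rw [← Finset.univ_sum_single x]
  exact map_sum c _ _

namespace MatrixPresentation

variable (P : MatrixPresentation S K) {N : Type*} [AddCommGroup N] [Module S N]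

theorem hom_ext {f g : K →ₗ[S] N} (h : ∀ j, f (P.gen j) = g (P.gen j)) : f = g := by
  ext x
  obtain ⟨a, rfl⟩ := P.exists_sum_eq x
  simp [h]

theorem exists_hom (x : Fin P.m → N) (hx : ∀ i, ∑ j, P.rel i j • x j = 0) :
    ∃ φ : K →ₗ[S] N, ∀ j, φ (P.gen j) = x j := by
  let p := Fintype.linearCombination S P.gen
  have hp : Function.Surjective p := P.exists_sum_eq
  have hle : LinearMap.ker p ≤ LinearMap.ker (Fintype.linearCombination S x) := fun a ha => by
    obtain ⟨b, hb⟩ := P.exists_rel a ha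
    rw [LinearMap.mem_ker, Fintype.linearCombination_apply]
    simp_rw [hb, Finset.sum_smul]
    rw [Finset.sum_comm]
    simp_rw [mul_smul, ← Finset.smul_sum, hx, smul_zero, Finset.sum_const_zero]
  refine ⟨(LinearMap.ker p).liftQ _ hle ∘ₗ (p.quotKerEquivOfSurjective hp).symm.toLinearMap,
    fun j => ?_⟩
  have : P.gen j = p (Pi.single j 1) := by simp [p]
  rw [this, LinearMap.comp_apply, LinearEquiv.coe_coe,
    LinearMap.quotKerEquivOfSurjective_symm_apply]
  simp

/-- Values on the generators embed Hom_S(K, N) in N^m, and characters extend along this embedding.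
-/
theorem exists_eq_sum_evalCharacter (Φ : CharacterModule (K →ₗ[S] N)) :
    ∃ f : Fin P.m → CharacterModule N, Φ = ∑ j, evalCharacter (f j) (P.gen j) := by
  obtain ⟨c, hc⟩ := CharacterModule.exists_comp_eq
    (AddMonoidHom.mk' (fun (φ : K →ₗ[S] N) j => φ (P.gen j)) fun _ _ => rfl) Φ fun φ hφ => by
      rw [P.hom_ext (g := 0) (congrFun hφ), map_zero]
  refine ⟨fun j => AddMonoidHom.comp (show (Fin P.m → N) →+ AddCircle (1 : ℚ) from c)
    (AddMonoidHom.single (fun _ : Fin P.m => N) j), CharacterModule.ext _ fun φ => ?_⟩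
  rw [← hc, CharacterModule.pi_apply, CharacterModule.sum_apply]
  rfl

/-- Dualizes exactness of Hom_S(K, N) → N^m → N^l. Together with the previous lemma, it presents
Hom_S(K, N)^* as the cokernel of a map from l to m copies of N^*. -/
theorem exists_of_sum_evalCharacter_eq_zero (f : Fin P.m → CharacterModule N)
    (hf : ∑ j, evalCharacter (S := S) (f j) (P.gen j) = 0) :
    ∃ h : Fin P.l → CharacterModule N, ∀ j, f j = ∑ i, op (P.rel i j) • h i := by
  let W : (Fin P.m → N) →+ (Fin P.l → N) :=
    AddMonoidHom.mk' (fun x i => ∑ j, P.rel i j • x j) fun x y => by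
      ext i
      simp [Finset.sum_add_distrib]
  let c : CharacterModule (Fin P.m → N) :=
    AddMonoidHom.mk' (fun x => ∑ j, f j (x j)) fun x y => by simp [Finset.sum_add_distrib]
  obtain ⟨c', hc'⟩ := CharacterModule.exists_comp_eq W c fun x hx => by
    obtain ⟨φ, hφ⟩ := P.exists_hom x (congrFun hx)
    have := DFunLike.congr_fun hf φ
    rw [CharacterModule.sum_apply] at this
    simp_rw [evalCharacter_apply, hφ] at this
    exact this
  refine ⟨fun i => AddMonoidHom.comp (show (Fin P.l → N) →+ AddCircle (1 : ℚ) from c')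
    (AddMonoidHom.single (fun _ : Fin P.l => N) i), fun j => CharacterModule.ext _ fun x => ?_⟩
  have h1 : c (Pi.single j x) = f j x := by
    change ∑ k, f k ((Pi.single j x : Fin P.m → N) k) = f j x
    rw [Finset.sum_eq_single j (fun k _ hk => by rw [Pi.single_eq_of_ne hk, map_zero]) (by simp),
      Pi.single_eq_same]
  have h2 : W (Pi.single j x) = fun i => P.rel i j • x := by
    ext i
    change ∑ k, P.rel i k • (Pi.single j x : Fin P.m → N) k = P.rel i j • x
    rw [Finset.sum_eq_single j (fun k _ hk => by rw [Pi.single_eq_of_ne hk, smul_zero]) (by simp),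
      Pi.single_eq_same]
  rw [← h1, ← hc', h2, CharacterModule.pi_apply, CharacterModule.sum_apply]
  rfl

end MatrixPresentation

end Presentation

/-! ### Double duals and (n,d)-injectivity -/

section DoubleDual

/-- The double dual `M^{**}`, a left module over the ring acting on `M`. -/
def DoubleDual (M : Type*) [AddCommGroup M] : Type _ :=
  CharacterModule (CharacterModule M)

instance (M : Type*) [AddCommGroup M] : AddCommGroup (DoubleDual M) :=
  inferInstanceAs (AddCommGroup (CharacterModule (CharacterModule M)))

noncomputable instance (S M : Type*) [Ring S] [AddCommGroup M] [Module S M] :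
    Module S (DoubleDual M) :=
  Module.compHom (CharacterModule (CharacterModule M)) (RingEquiv.opOp S).toRingHom

variable {S : Type u} [Ring S] {K I : Type u} [AddCommGroup K] [Module S K] [AddCommGroup I]
  [Module S I]

variable (S K I) in
/-- The natural map `Hom_S(K, I)^{**} → Hom_S(K, I^{**})`. -/
noncomputable def doubleDualHom : DoubleDual (K →ₗ[S] I) →+ (K →ₗ[S] DoubleDual I) :=
  AddMonoidHom.mk' (fun Φ =>
    { toFun := fun x => show CharacterModule (CharacterModule I) from
        AddMonoidHom.mk' (fun f =>
          (show CharacterModule (CharacterModule (K →ₗ[S] I)) from Φ) (evalCharacter f x))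
          fun f g => by rw [evalCharacter_add_left, map_add]
      map_add' := fun x y => CharacterModule.ext _ fun f => by
        refine (congrArg (show CharacterModule (CharacterModule (K →ₗ[S] I)) from Φ)
          (evalCharacter_add f x y)).trans (map_add _ _ _)
      map_smul' := fun s x => CharacterModule.ext _ fun f =>
        congrArg (show CharacterModule (CharacterModule (K →ₗ[S] I)) from Φ)
          (evalCharacter_smul f s x) })
    fun _ _ => rfl

theorem doubleDualHom_apply (Φ : DoubleDual (K →ₗ[S] I)) (x : K) (f : CharacterModule I) :
    (show CharacterModule (CharacterModule I) from doubleDualHom S K I Φ x) f =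
      (show CharacterModule (CharacterModule (K →ₗ[S] I)) from Φ) (evalCharacter f x) :=
  rfl

/-- A map K → I^{**} is a tuple of values on the generators satisfying the relations, which is also
what a character of the cokernel describing Hom_S(K, I)^* amounts to. -/
theorem MatrixPresentation.bijective_doubleDualHom (P : MatrixPresentation S K) :
    Function.Bijective (doubleDualHom S K I) := by
  constructor
  · refine (injective_iff_map_eq_zero _).2 fun Φ hΦ => CharacterModule.ext _ fun c => ?_
    obtain ⟨f, rfl⟩ := P.exists_eq_sum_evalCharacter c
    refine (map_sum (show CharacterModule (CharacterModule (K →ₗ[S] I)) from Φ) _ _).trans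
      (Finset.sum_eq_zero fun j _ => ?_)
    rw [← doubleDualHom_apply, hΦ]
    rfl
  · intro g
    let g' : K → CharacterModule (CharacterModule I) := g
    let ρ : (Fin P.m → CharacterModule I) →+ CharacterModule (K →ₗ[S] I) :=
      AddMonoidHom.mk' (fun f => ∑ j, evalCharacter (f j) (P.gen j)) fun f f' => by
        simp [evalCharacter_add_left, Finset.sum_add_distrib]
    let c : CharacterModule (Fin P.m → CharacterModule I) :=
      AddMonoidHom.mk' (fun f => ∑ j, g' (P.gen j) (f j)) fun f f' => by
        simp [Finset.sum_add_distrib]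
    obtain ⟨Φ, hΦ⟩ := CharacterModule.exists_comp_eq ρ c fun f hf => by
      obtain ⟨h, hh⟩ := P.exists_of_sum_evalCharacter_eq_zero f hf
      change ∑ j, g' (P.gen j) (f j) = 0
      have hs : ∀ (s : S) x f, g' (s • x) f = g' x (op s • f) := fun s x f =>
        DFunLike.congr_fun (f := (show CharacterModule (CharacterModule I) from g (s • x)))
          (map_smul g s x) f
      have ha : ∀ i, ∑ j, g' (P.rel i j • P.gen j) = 0 := fun i => by
        refine Eq.trans (map_sum g _ _).symm ?_
        rw [P.sum_rel, map_zero]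
        rfl
      simp_rw [hh, map_sum, ← hs]
      rw [Finset.sum_comm]
      refine Finset.sum_eq_zero fun i _ => ?_
      rw [← CharacterModule.sum_apply, ha]
      rfl
    refine ⟨Φ, P.hom_ext fun j => CharacterModule.ext _ fun f => ?_⟩
    have hj := hΦ (Pi.single j f)
    have h1 : ρ (Pi.single j f) = evalCharacter f (P.gen j) := by
      change ∑ k, evalCharacter ((Pi.single j f : Fin P.m → CharacterModule I) k) (P.gen k) = _
      rw [Finset.sum_eq_single j (fun k _ hk => by rw [Pi.single_eq_of_ne hk]; rfl) (by simp),
        Pi.single_eq_same]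
    have h2 : c (Pi.single j f) = g' (P.gen j) f := by
      change ∑ k, g' (P.gen k) ((Pi.single j f : Fin P.m → CharacterModule I) k) = _
      rw [Finset.sum_eq_single j (fun k _ hk => by rw [Pi.single_eq_of_ne hk, map_zero]) (by simp),
        Pi.single_eq_same]
    rw [h1, h2] at hj
    exact hj

/-- The dual homomorphism `Y^* → X^*` of `r : X → Y`. -/
def CharacterModule.precompHom {X Y : Type*} [AddCommGroup X] [AddCommGroup Y] (r : X →+ Y) :
    CharacterModule Y →+ CharacterModule X :=
  AddMonoidHom.mk' (fun c => AddMonoidHom.comp (show Y →+ AddCircle (1 : ℚ) from c) r)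
    fun _ _ => rfl

theorem surjective_iff_doubleDual {X Y : Type*} [AddCommGroup X] [AddCommGroup Y] (r : X →+ Y) :
    Function.Surjective r ↔ ∀ Φ : CharacterModule (CharacterModule Y),
      ∃ Ψ : CharacterModule (CharacterModule X), ∀ c : CharacterModule Y,
        Ψ (CharacterModule.precompHom r c) = Φ c := by
  refine ⟨fun h Φ => ?_, fun h y => ?_⟩
  · refine CharacterModule.exists_comp_eq (CharacterModule.precompHom r) Φ fun c hc => ?_
    have : c = 0 := CharacterModule.ext _ fun y => by
      obtain ⟨x, rfl⟩ := h y
      exact DFunLike.congr_fun hc x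
    rw [this, map_zero]
  · by_contra hn
    obtain ⟨c, hc, hcy⟩ := CharacterModule.exists_apply_ne_zero_of_notMem (H := r.range) hn
    -- Testing on evaluation at the missed element y: the character c is killed by the dual of r,
    -- yet c y ≠ 0.
    obtain ⟨Ψ, hΨ⟩ := h (AddMonoidHom.mk' (fun c : CharacterModule Y => c y) fun _ _ => rfl)
    have h0 : CharacterModule.precompHom r c = 0 :=
      CharacterModule.ext _ fun x => hc _ ⟨x, rfl⟩
    have h1 := hΨ c
    rw [h0] at h1
    exact hcy (h1.symm.trans (map_zero Ψ))

/-- By naturality, restriction along i with values in I^{**} is the double dual of restriction with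
values in I. -/
theorem forall_extension_iff_doubleDual {X Y : Type u} [AddCommGroup X] [Module S X]
    [AddCommGroup Y] [Module S Y] (P : MatrixPresentation S X) (Q : MatrixPresentation S Y)
    (i : X →ₗ[S] Y) :
    (∀ g : X →ₗ[S] I, ∃ g' : Y →ₗ[S] I, g' ∘ₗ i = g) ↔
      ∀ g : X →ₗ[S] DoubleDual I, ∃ g' : Y →ₗ[S] DoubleDual I, g' ∘ₗ i = g := by
  let r : (Y →ₗ[S] I) →+ (X →ₗ[S] I) :=
    AddMonoidHom.mk' (fun φ : Y →ₗ[S] I => φ ∘ₗ i) fun _ _ => rfl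
  have hr : ∀ (Ψ : DoubleDual (X →ₗ[S] I)) (Φ : DoubleDual (Y →ₗ[S] I)),
      (∀ c, (show CharacterModule (CharacterModule (Y →ₗ[S] I)) from Φ)
        (CharacterModule.precompHom r c) =
          (show CharacterModule (CharacterModule (X →ₗ[S] I)) from Ψ) c) ↔
      doubleDualHom S Y I Φ ∘ₗ i = doubleDualHom S X I Ψ := fun Ψ Φ => by
    let Φ' : DoubleDual (X →ₗ[S] I) :=
      CharacterModule.precompHom (CharacterModule.precompHom r) Φ
    have h1 : doubleDualHom S Y I Φ ∘ₗ i = doubleDualHom S X I Φ' := rfl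
    rw [h1, (P.bijective_doubleDualHom (I := I)).1.eq_iff]
    exact ⟨fun h => CharacterModule.ext _ h, fun h c => DFunLike.congr_fun
      (F := CharacterModule (CharacterModule (X →ₗ[S] I))) h c⟩
  refine (surjective_iff_doubleDual r).trans ⟨fun h g => ?_, fun h Φ => ?_⟩
  · obtain ⟨Φ, rfl⟩ := (P.bijective_doubleDualHom (I := I)).2 g
    obtain ⟨Ψ, hΨ⟩ := h Φ
    exact ⟨doubleDualHom S Y I Ψ, (hr _ _).1 hΨ⟩
  · obtain ⟨g', hg'⟩ := h (doubleDualHom S X I Φ)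
    obtain ⟨Ψ, rfl⟩ := (Q.bijective_doubleDualHom (I := I)).2 g'
    exact ⟨Ψ, (hr _ _).2 hg'⟩

/-- Each dimension shift costs one step of the presentation. In degree 1 the kernel of the cover
must still be finitely presented, which accounts for the length d + 2. -/
theorem IsFP.subsingleton_ext_iff_doubleDual {d : ℕ} {U : Type u} [AddCommGroup U] [Module S U]
    (hU : IsFP S (d + 2) U) : Subsingleton (ExtGroup S (d + 1) U I) ↔
      Subsingleton (ExtGroup S (d + 1) U (DoubleDual I)) := by
  induction d generalizing U with
  | zero =>
    obtain ⟨m, f, hf, hk⟩ := hU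
    obtain ⟨P⟩ := hk.nonempty_matrixPresentation
    obtain ⟨Q⟩ := (IsFP.pi_fin (A := S) 1 m).nonempty_matrixPresentation
    have key := forall_extension_iff_doubleDual (I := I) P Q (LinearMap.ker f).subtype
    have hi := (LinearMap.ker f).injective_subtype
    have he := LinearMap.exact_subtype_ker_map f
    have aux : ∀ (M : Type u) [AddCommGroup M] [Module S M], Subsingleton (ExtGroup S 1 U M) ↔
        ∀ g : LinearMap.ker f →ₗ[S] M, ∃ g' : (Fin m → S) →ₗ[S] M,
          g' ∘ₗ (LinearMap.ker f).subtype = g := fun M _ _ =>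
      ⟨exists_extension_of_subsingleton_ext_one hi he hf,
        subsingleton_ext_one_of_extension hi he hf (subsingleton_ext_succ_of_projective 0)⟩
    exact (aux I).trans (key.trans (aux (DoubleDual I)).symm)
  | succ d ih =>
    obtain ⟨m, f, hf, hk⟩ := hU
    have hi := (LinearMap.ker f).injective_subtype
    have he := LinearMap.exact_subtype_ker_map f
    have aux : ∀ (M : Type u) [AddCommGroup M] [Module S M],
        Subsingleton (ExtGroup S (d + 2) U M) ↔
          Subsingleton (ExtGroup S (d + 1) (LinearMap.ker f) M) := fun M _ _ =>
      ⟨subsingleton_ext_left hi he hf _ (subsingleton_ext_succ_of_projective _), fun h =>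
        subsingleton_ext_right hi he hf _ h (subsingleton_ext_succ_of_projective _)⟩
    exact (aux I).trans ((ih hk).trans (aux (DoubleDual I)).symm)

theorem isNDInjective_iff_doubleDual {n d : ℕ} (hn : d + 1 < n) :
    IsNDInjective S n d I ↔ IsNDInjective S n d (DoubleDual I) :=
  forall_congr' fun _ => forall_congr' fun _ => forall_congr' fun _ => forall_congr' fun hU =>
    (hU.isFP.of_le hn).subsingleton_ext_iff_doubleDual

end DoubleDual

/-! ### Dimension shifting along syzygies -/

section Syzygy

variable {A : Type u} [Ring A] {U V : Type u} [AddCommGroup U] [Module A U] [AddCommGroup V]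
  [Module A V]

/-- Transport of a free presentation along an isomorphism. -/
def FreePresentation.congr {n : ℕ∞} (P : FreePresentation A n U) (e : U ≃ₗ[A] V) :
    FreePresentation A n V where
  __ := P
  ε := e.toLinearMap ∘ₗ P.ε
  surjective := e.surjective.comp P.surjective
  exact_zero h x := by
    rw [← P.exact_zero h x]
    exact e.map_eq_zero_iff

/-- Truncation of an infinite free presentation. -/
def FreePresentation.truncate (P : FreePresentation A ⊤ U) (n : ℕ∞) : FreePresentation A n U where
  __ := P
  free i _ := P.free i le_top
  finite i _ := P.finite i le_top
  exact_zero _ := P.exact_zero le_top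
  exact_succ i _ := P.exact_succ i le_top

theorem FreePresentation.exists_cover (P : FreePresentation A ⊤ U) :
    ∃ (m : ℕ) (f : (Fin m → A) →ₗ[A] U), Function.Surjective f ∧
      Nonempty (FreePresentation A ⊤ (LinearMap.ker f)) := by
  have := P.free 0 le_top
  have := P.finite 0 le_top
  obtain ⟨m, f, hf, ⟨e⟩⟩ := exists_pi_fin_cover P.ε P.surjective
  exact ⟨m, f, hf, ⟨(P.shift fun _ _ => le_top).congr e⟩⟩

theorem FreePresentation.IsSyzygy.shift {P : FreePresentation A ⊤ U} {k : ℕ}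
    (h : P.IsSyzygy V (k + 1)) : (P.shift (n' := ⊤) fun _ _ => le_top).IsSyzygy V k :=
  match k, h with
  | 0, h => h
  | 1, ⟨e⟩ => ⟨e.trans (LinearEquiv.ofEq _ _ (LinearMap.ker_codRestrict _ _ _).symm)⟩
  | _ + 2, h => h

theorem FreePresentation.IsSyzygy.nonempty {P : FreePresentation A ⊤ U} {k : ℕ}
    (h : P.IsSyzygy V k) : Nonempty (FreePresentation A ⊤ V) := by
  induction k generalizing U with
  | zero => exact h.map fun e => P.congr e.symm
  | succ k ih => exact ih h.shift

variable {I : Type u} [AddCommGroup I] [Module A I] {n d : ℕ}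

/-- Syzygies of U are again super finitely presented, so shifting reduces to degree d + 1, where the
definition applies. -/
theorem FreePresentation.subsingleton_ext (hI : IsNDInjective A n d I)
    (P : FreePresentation A ⊤ U) (j : ℕ) : Subsingleton (ExtGroup A (j + d + 1) U I) := by
  induction j generalizing U with
  | zero => rw [zero_add]; exact hI U ⟨P.truncate n⟩
  | succ j ih =>
    obtain ⟨m, f, hf, ⟨P'⟩⟩ := P.exists_cover
    have := subsingleton_ext_right (LinearMap.ker f).injective_subtype
      (LinearMap.exact_subtype_ker_map f) hf (j + d + 1) (ih P')
      (subsingleton_ext_succ_of_projective _)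
    rwa [show j + 1 + d + 1 = j + d + 1 + 1 by ring]

/-- The index k counts successive kernels, each lowering the degree by one. For k = d this turns the
previous vanishing for C into vanishing in all positive degrees for K. -/
theorem FreePresentation.IsSyzygy.subsingleton_ext {P : FreePresentation A ⊤ U} {k : ℕ}
    (h : P.IsSyzygy V k) (j : ℕ) (hU : Subsingleton (ExtGroup A (j + k + 1) U I)) :
    Subsingleton (ExtGroup A (j + 1) V I) := by
  induction k generalizing U with
  | zero =>
    obtain ⟨e⟩ := h
    exact subsingleton_ext_congr e.symm (LinearEquiv.refl A I) _ hU
  | succ k ih =>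
    have := P.free 0 le_top
    exact ih h.shift (subsingleton_ext_left (LinearMap.ker P.ε).injective_subtype
      (LinearMap.exact_subtype_ker_map P.ε) P.surjective _
      (subsingleton_ext_succ_of_projective _) hU)

end Syzygy

/-! ### The coresolution by copies of K and the evaluation isomorphism -/

section Bass

variable {S T : Type u} [Ring S] [Ring T] {K : Type u} [AddCommGroup K] [Module S K] [Module T K]
  [SMulCommClass S T K]

section HomSequence

variable (T K) {U : Type u} [AddCommGroup U] [Module S U] {m : ℕ} (f : (Fin m → S) →ₗ[S] U)

/-- The map `Hom_S(U, K) → K^m` given by the generators of `U`. -/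
def homToPi : (U →ₗ[S] K) →ₗ[T] (Fin m → K) where
  toFun φ j := φ (f (Pi.single j 1))
  map_add' _ _ := rfl
  map_smul' _ _ := rfl

/-- The map `K^m → Hom_S(ker f, K)` given by restriction from `S^m`. -/
def piToHomKer : (Fin m → K) →ₗ[T] (LinearMap.ker f →ₗ[S] K) where
  toFun x := Fintype.linearCombination S x ∘ₗ (LinearMap.ker f).subtype
  map_add' x y := LinearMap.ext fun a => by
    simp [Fintype.linearCombination_apply, Finset.sum_add_distrib]
  map_smul' t x := LinearMap.ext fun a => by
    simp [Fintype.linearCombination_apply, Finset.smul_sum, smul_comm]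

variable {f}

theorem homToPi_injective (hf : Function.Surjective f) : Function.Injective (homToPi T K f) := by
  intro φ ψ h
  ext x
  obtain ⟨a, rfl⟩ := hf x
  rw [linearMap_pi_apply f a, map_sum, map_sum]
  exact Finset.sum_congr rfl fun j _ => by rw [map_smul, map_smul]; exact congrArg _ (congrFun h j)

theorem homToPi_exact (hf : Function.Surjective f) :
    Function.Exact (homToPi T K f) (piToHomKer T K f) := by
  intro x
  constructor
  · intro hx
    have hle : LinearMap.ker f ≤ LinearMap.ker (Fintype.linearCombination S x) := fun a ha =>
      LinearMap.congr_fun hx ⟨a, ha⟩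
    refine ⟨(LinearMap.ker f).liftQ _ hle ∘ₗ (f.quotKerEquivOfSurjective hf).symm.toLinearMap, ?_⟩
    ext j
    change ((LinearMap.ker f).liftQ _ hle) ((f.quotKerEquivOfSurjective hf).symm _) = _
    rw [LinearMap.quotKerEquivOfSurjective_symm_apply]
    simp
  · rintro ⟨φ, rfl⟩
    ext a
    change Fintype.linearCombination S (fun j => φ (f (Pi.single j 1))) a.1 = 0
    rw [Fintype.linearCombination_apply, ← map_zero φ, ← a.2, linearMap_pi_apply f a.1, map_sum]
    simp

theorem piToHomKer_surjective (hf : Function.Surjective f)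
    (h : Subsingleton (ExtGroup S 1 U K)) : Function.Surjective (piToHomKer T K f) := by
  intro g
  obtain ⟨g', rfl⟩ := exists_extension_of_subsingleton_ext_one
    (LinearMap.ker f).injective_subtype (LinearMap.exact_subtype_ker_map f) hf h g
  refine ⟨fun j => g' (Pi.single j 1), LinearMap.ext fun a => ?_⟩
  exact (linearMap_pi_apply g' a.1).symm

end HomSequence

variable (S T K) in
/-- The `S`-modules `U` with an infinite resolution by finitely generated free modules, with
`Ext_S^{j+1}(U, K) = 0`, and whose `K`-dual has finite free presentations of every length
over `T`. -/
structure IsDualAdmissible (U : Type u) [AddCommGroup U] [Module S U] : Prop where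
  nonempty : Nonempty (FreePresentation S ⊤ U)
  ext : ∀ j, Subsingleton (ExtGroup S (j + 1) U K)
  isFP : ∀ n, IsFP T n (U →ₗ[S] K)

/-- Since Ext_S^1(U, K) = 0, the sequence 0 → Hom_S(U, K) → K^m → Hom_S(ker f, K) → 0 is exact, so
finiteness over T passes to its last term. -/
theorem IsDualAdmissible.exists_cover {U : Type u} [AddCommGroup U] [Module S U]
    (hK : ∀ n, IsFP T n K) (h : IsDualAdmissible S T K U) :
    ∃ (m : ℕ) (f : (Fin m → S) →ₗ[S] U), Function.Surjective f ∧
      IsDualAdmissible S T K (LinearMap.ker f) := by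
  obtain ⟨P⟩ := h.nonempty
  obtain ⟨m, f, hf, hP⟩ := P.exists_cover
  refine ⟨m, f, hf, hP, fun j => subsingleton_ext_left (LinearMap.ker f).injective_subtype
    (LinearMap.exact_subtype_ker_map f) hf (j + 1) (subsingleton_ext_succ_of_projective _)
    (h.ext (j + 1)), fun n => ?_⟩
  exact (IsFP.right (homToPi_injective T K hf) (homToPi_exact T K hf)
    (piToHomKer_surjective T K hf (h.ext 0)) (h.isFP n) ((hK (n + 1)).pi m)).of_succ

variable {I : Type u} [AddCommGroup I] [Module T I] {n d : ℕ}

/-- Passing from U to the kernel of a cover raises the degree by one, as K^m has no positive Ext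
into I. After a steps the degree is d + 1, where (n,d)-injectivity applies. -/
theorem IsDualAdmissible.subsingleton_ext (hI : IsNDInjective T n d I) (hK : ∀ n, IsFP T n K)
    (hKI : ∀ j, Subsingleton (ExtGroup T (j + 1) K I)) {U : Type u} [AddCommGroup U] [Module S U]
    (h : IsDualAdmissible S T K U) (a j : ℕ) (hj : a + j = d) :
    Subsingleton (ExtGroup T (j + 1) (U →ₗ[S] K) I) := by
  induction a generalizing U j with
  | zero =>
    obtain rfl : j = d := by omega
    exact hI _ (h.isFP n).isFinitelyNPresented
  | succ a ih =>
    obtain ⟨m, f, hf, h'⟩ := h.exists_cover hK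
    exact subsingleton_ext_left (homToPi_injective T K hf) (homToPi_exact T K hf)
      (piToHomKer_surjective T K hf (h.ext 0)) _ (subsingleton_ext_pi _ (hKI j) m)
      (ih h' (j + 1) (by omega))

theorem IsDualAdmissible.exists_extension (hI : IsNDInjective T n d I) (hK : ∀ n, IsFP T n K)
    (hKI : ∀ j, Subsingleton (ExtGroup T (j + 1) K I)) {U : Type u} [AddCommGroup U] [Module S U]
    {m : ℕ} {f : (Fin m → S) →ₗ[S] U} (hf : Function.Surjective f)
    (h : Subsingleton (ExtGroup S 1 U K)) (h' : IsDualAdmissible S T K (LinearMap.ker f))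
    (g : (U →ₗ[S] K) →ₗ[T] I) :
    ∃ g' : (Fin m → K) →ₗ[T] I, g' ∘ₗ homToPi T K f = g :=
  exists_extension_of_subsingleton_ext_one (homToPi_injective T K hf) (homToPi_exact T K hf)
    (piToHomKer_surjective T K hf h) (h'.subsingleton_ext hI hK hKI d 0 rfl) g

variable (S T K d) in
/-- A bimodule `K`, with commuting left actions of `S` and `T`, having an infinite resolution by
finitely generated free `S`-modules, with `Ext_S^{j+1}(K, K) = 0`, whose `S`-endomorphisms are the
homotheties by elements of `T`, and which over `T` is a `d`-fold syzygy of a super finitely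
presented module. -/
structure IsSyzygyDualizing : Prop where
  nonempty : Nonempty (FreePresentation S ⊤ K)
  ext : ∀ j, Subsingleton (ExtGroup S (j + 1) K K)
  homothety : ∀ φ : K →ₗ[S] K, ∃ t : T, ∀ x, φ x = t • x
  faithful : ∀ t : T, (∀ x : K, t • x = 0) → t = 0
  syzygy : ∃ (C : Type u) (_ : AddCommGroup C) (_ : Module T C) (P : FreePresentation T ⊤ C),
    P.IsSyzygy K d

namespace IsSyzygyDualizing

omit [SMulCommClass S T K] in
theorem isFP (h : IsSyzygyDualizing S T K d) (n : ℕ) : IsFP T n K := by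
  obtain ⟨C, _, _, P, hP⟩ := h.syzygy
  obtain ⟨Q⟩ := hP.nonempty
  exact IsFinitelyNPresented.isFP ⟨Q.truncate n⟩

omit [SMulCommClass S T K] in
theorem subsingleton_ext (h : IsSyzygyDualizing S T K d) (hI : IsNDInjective T n d I) (j : ℕ) :
    Subsingleton (ExtGroup T (j + 1) K I) := by
  obtain ⟨C, _, _, P, hP⟩ := h.syzygy
  exact hP.subsingleton_ext j (P.subsingleton_ext hI j)

/-- The isomorphism `T ≃ Hom_S(K, K)`. -/
noncomputable def homothetyEquiv (h : IsSyzygyDualizing S T K d) : T ≃ₗ[T] (K →ₗ[S] K) :=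
  LinearEquiv.ofBijective (LinearMap.toSpanSingleton T (K →ₗ[S] K) LinearMap.id)
    ⟨(injective_iff_map_eq_zero _).2 fun t ht => h.faithful t fun x => LinearMap.congr_fun ht x,
      fun φ => by
        obtain ⟨t, ht⟩ := h.homothety φ
        exact ⟨t, LinearMap.ext fun x => (ht x).symm⟩⟩

theorem isDualAdmissible (h : IsSyzygyDualizing S T K d) : IsDualAdmissible S T K K where
  nonempty := h.nonempty
  ext := h.ext
  isFP n := ((IsFP.pi_fin n 1).congr (LinearEquiv.funUnique (Fin 1) T T)).congr h.homothetyEquiv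

/-- Hom_T(-, I) keeps 0 → T → K^m → K^l exact. The two clauses say that Hom_T(K, I) ⊗_S K → I is an
isomorphism, expressed through a presentation of K. -/
theorem exists_matrixPresentation (h : IsSyzygyDualizing S T K d) (hI : IsNDInjective T n d I) :
    ∃ P : MatrixPresentation S K,
      (∀ y : I, ∃ ψ : Fin P.m → (K →ₗ[T] I), ∑ j, ψ j (P.gen j) = y) ∧
      ∀ ψ : Fin P.m → (K →ₗ[T] I), ∑ j, ψ j (P.gen j) = 0 →
        ∃ χ : Fin P.l → (K →ₗ[T] I), ∀ j x, ψ j x = ∑ i, χ i (P.rel i j • x) := by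
  have hK := h.isFP
  have hKI := h.subsingleton_ext hI
  obtain ⟨m, f, hf, hA⟩ := h.isDualAdmissible.exists_cover hK
  obtain ⟨l, g, hg, hA'⟩ := hA.exists_cover hK
  refine ⟨.ofSurjective f hf g hg, fun y => ?_, fun (ψ : Fin m → (K →ₗ[T] I))
    (hψ : ∑ j, ψ j (f (Pi.single j 1)) = 0) => ?_⟩
  -- The map T ≅ Hom_S(K, K) → I with 1 ↦ y is extended to K^m; the identity of K sits there as the
  -- tuple of generators.
  · obtain ⟨ψ, hψ⟩ := hA.exists_extension hI hK hKI hf (h.ext 0)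
      (LinearMap.toSpanSingleton T I y ∘ₗ h.homothetyEquiv.symm.toLinearMap)
    refine ⟨fun j => ψ ∘ₗ LinearMap.single T (fun _ => K) j, ?_⟩
    have h1 : h.homothetyEquiv.symm LinearMap.id = 1 := by
      rw [LinearEquiv.symm_apply_eq]
      exact (one_smul T _).symm
    have h2 := LinearMap.congr_fun hψ LinearMap.id
    rw [LinearMap.comp_apply, LinearMap.comp_apply, LinearEquiv.coe_coe, h1,
      LinearMap.toSpanSingleton_apply, one_smul] at h2
    rw [← h2, ← Finset.univ_sum_single (homToPi T K f LinearMap.id), map_sum]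
    rfl
  · let ψ' : (Fin m → K) →ₗ[T] I := ∑ j, ψ j ∘ₗ LinearMap.proj j
    have hψ' : ∀ x, ψ' x = ∑ j, ψ j (x j) := fun x => by simp [ψ']
    have hsurj := piToHomKer_surjective T K hf (h.ext 0)
    -- By exactness and the homothety condition, the kernel consists of the T-multiples of the tuple
    -- of generators, on which ψ' vanishes by hypothesis.
    have hle : LinearMap.ker (piToHomKer T K f) ≤ LinearMap.ker ψ' := fun x hx => by
      obtain ⟨φ, rfl⟩ := (homToPi_exact T K hf x).1 hx
      obtain ⟨t, ht⟩ := h.homothety φ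
      rw [LinearMap.mem_ker, hψ', ← smul_zero t, ← hψ, Finset.smul_sum]
      refine Finset.sum_congr rfl fun j _ => ?_
      rw [← map_smul, ← ht]
      rfl
    -- Hence ψ' descends to Hom_S(ker f, K), and from there extends to K^l.
    obtain ⟨χ, hχ⟩ := hA'.exists_extension hI hK hKI hg (hA.ext 0)
      ((LinearMap.ker (piToHomKer T K f)).liftQ ψ' hle ∘ₗ
        ((piToHomKer T K f).quotKerEquivOfSurjective hsurj).symm.toLinearMap)
    refine ⟨fun i => χ ∘ₗ LinearMap.single T (fun _ => K) i, fun (j : Fin m) x => ?_⟩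
    have h1 := LinearMap.congr_fun hχ (piToHomKer T K f (Pi.single j x))
    rw [LinearMap.comp_apply, LinearMap.comp_apply, LinearEquiv.coe_coe,
      LinearMap.quotKerEquivOfSurjective_symm_apply, Submodule.liftQ_apply, hψ',
      Finset.sum_eq_single j (fun k _ hk => by rw [Pi.single_eq_of_ne hk, map_zero]) (by simp),
      Pi.single_eq_same] at h1
    have h2 : homToPi T K g (piToHomKer T K f (Pi.single j x)) =
        fun i => (g (Pi.single i 1)).1 j • x := by
      ext i
      change Fintype.linearCombination S (Pi.single j x : Fin m → K) (g (Pi.single i 1)).1 = _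
      rw [Fintype.linearCombination_apply, Finset.sum_eq_single j
        (fun k _ hk => by rw [Pi.single_eq_of_ne hk, smul_zero]) (by simp), Pi.single_eq_same]
    rw [← h1, h2, ← Finset.univ_sum_single (fun i => (g (Pi.single i 1)).1 j • x), map_sum]
    rfl

theorem _root_.AddMonoidHom.exists_addEquiv_of_ker_iff {X Y Z : Type*} [AddCommGroup X]
    [AddCommGroup Y] [AddCommGroup Z] (f : X →+ Y) (g : X →+ Z) (hf : Function.Surjective f)
    (hg : Function.Surjective g) (h : ∀ x, f x = 0 ↔ g x = 0) :
    ∃ e : Y ≃+ Z, ∀ x, e (f x) = g x := by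
  have hker : f.ker = g.ker := AddSubgroup.ext h
  let e := ((QuotientAddGroup.quotientKerEquivOfSurjective f hf).symm.trans
    (QuotientAddGroup.quotientAddEquivOfEq hker)).trans
      (QuotientAddGroup.quotientKerEquivOfSurjective g hg)
  refine ⟨e, fun x => ?_⟩
  have : (QuotientAddGroup.quotientKerEquivOfSurjective f hf).symm (f x) = (x : X ⧸ f.ker) := by
    rw [AddEquiv.symm_apply_eq]
    rfl
  simp only [e, AddEquiv.trans_apply, this]
  rfl

/-- Through α, both I and Hom_S(K, N)^* are quotients of m copies of N^* by the same relations: for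
I by the preceding presentation, for the dual by the character lemmas. -/
theorem exists_addEquiv_characterModule (h : IsSyzygyDualizing S T K d)
    (hI : IsNDInjective T n d I) {N : Type u} [AddCommGroup N] [Module S N]
    (α : CharacterModule N ≃+ (K →ₗ[T] I))
    (hα : ∀ (s : S) (f : CharacterModule N) (x : K), α (op s • f) x = α f (s • x)) :
    ∃ θ : I ≃+ CharacterModule (K →ₗ[S] N), (∀ f x, θ (α f x) = evalCharacter f x) ∧
      ∀ (t : T) (y : I) (φ φ' : K →ₗ[S] N), (∀ x, φ' x = φ (t • x)) → θ (t • y) φ = θ y φ' := by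
  obtain ⟨P, h1, h2⟩ := h.exists_matrixPresentation hI
  let a : (Fin P.m → CharacterModule N) →+ I :=
    AddMonoidHom.mk' (fun f => ∑ j, α (f j) (P.gen j)) fun f f' => by
      simp [Finset.sum_add_distrib]
  let b : (Fin P.m → CharacterModule N) →+ CharacterModule (K →ₗ[S] N) :=
    AddMonoidHom.mk' (fun f => ∑ j, evalCharacter (f j) (P.gen j)) fun f f' => by
      simp [evalCharacter_add_left, Finset.sum_add_distrib]
  have ha : ∀ f, a f = ∑ j, α (f j) (P.gen j) := fun _ => rfl
  have hb : ∀ f, b f = ∑ j, evalCharacter (f j) (P.gen j) := fun _ => rfl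
  have ha0 : ∀ h : Fin P.l → CharacterModule N,
      a (fun j => ∑ i, op (P.rel i j) • h i) = 0 := fun h => by
    simp_rw [ha, map_sum, LinearMap.sum_apply, hα]
    rw [Finset.sum_comm]
    simp_rw [← map_sum, P.sum_rel, map_zero, Finset.sum_const_zero]
  have hb0 : ∀ h : Fin P.l → CharacterModule N,
      b (fun j => ∑ i, op (P.rel i j) • h i) = 0 := fun h => by
    have hs : ∀ (f : Fin P.l → CharacterModule N) (x : K),
        evalCharacter (S := S) (∑ i, f i) x = ∑ i, evalCharacter (f i) x := fun f x =>
      map_sum (AddMonoidHom.mk' (fun f : CharacterModule N => evalCharacter (S := S) f x)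
        fun f g => evalCharacter_add_left f g x) f _
    simp_rw [hb, hs, ← evalCharacter_smul]
    rw [Finset.sum_comm]
    simp_rw [← evalCharacter_sum, P.sum_rel]
    exact Finset.sum_eq_zero fun i _ => CharacterModule.ext _ fun φ =>
      (congrArg (h i) (map_zero φ)).trans (map_zero (h i))
  obtain ⟨θ, hθ⟩ := AddMonoidHom.exists_addEquiv_of_ker_iff a b
    (fun y => by
      obtain ⟨ψ, hψ⟩ := h1 y
      exact ⟨fun j => α.symm (ψ j), by simp [ha, hψ]⟩)
    (fun Φ => by
      obtain ⟨f, hf⟩ := P.exists_eq_sum_evalCharacter Φ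
      exact ⟨f, hf.symm⟩)
    fun f => ⟨fun hf => by
      obtain ⟨χ, hχ⟩ := h2 (fun j => α (f j)) hf
      have : f = fun j => ∑ i, op (P.rel i j) • α.symm (χ i) := by
        ext1 j
        apply α.injective
        ext x
        simp [hχ, hα]
      rw [this, hb0], fun hf => by
      obtain ⟨h, hh⟩ := P.exists_of_sum_evalCharacter_eq_zero f hf
      rw [show f = _ from funext hh, ha0]⟩
  have key : ∀ f x, θ (α f x) = evalCharacter f x := fun f x => by
    obtain ⟨c, rfl⟩ := P.exists_sum_eq x
    have e1 : α f (∑ j, c j • P.gen j) = a fun j => op (c j) • f := by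
      rw [ha, map_sum]
      exact Finset.sum_congr rfl fun j _ => (hα _ _ _).symm
    rw [e1, hθ, hb, evalCharacter_sum]
    exact Finset.sum_congr rfl fun j _ => (evalCharacter_smul _ _ _).symm
  refine ⟨θ, key, fun t y φ φ' hφ => ?_⟩
  obtain ⟨ψ, rfl⟩ := h1 y
  simp_rw [Finset.smul_sum, ← map_smul]
  rw [map_sum, map_sum, CharacterModule.sum_apply, CharacterModule.sum_apply]
  refine Finset.sum_congr rfl fun j _ => ?_
  obtain ⟨f, hf⟩ := α.surjective (ψ j)
  rw [← hf, key, key, evalCharacter_apply, evalCharacter_apply, hφ]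

end IsSyzygyDualizing

end Bass

/-! ### Dual isomorphisms and the evaluation map -/

theorem CharacterModule.bijective_of_precompHom {X Y : Type*} [AddCommGroup X] [AddCommGroup Y]
    {r : X →+ Y} (h : Function.Bijective (CharacterModule.precompHom r)) : Function.Bijective r :=
  (CharacterModule.dual_bijective_iff_bijective (R := ℤ) (f := r.toIntLinearMap)).1 h

/-- The isomorphism `X^* ≃ Y^*` induced by `X ≃ Y`. -/
def CharacterModule.congrAddEquiv {X Y : Type*} [AddCommGroup X] [AddCommGroup Y] (e : X ≃+ Y) :
    CharacterModule X ≃+ CharacterModule Y where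
  toFun := CharacterModule.precompHom e.symm.toAddMonoidHom
  invFun := CharacterModule.precompHom e.toAddMonoidHom
  left_inv c := CharacterModule.ext _ fun x => congrArg c (e.symm_apply_apply x)
  right_inv c := CharacterModule.ext _ fun x => congrArg c (e.apply_symm_apply x)
  map_add' _ _ := rfl

/-- `Hom_S(K, N)` for an `(S, R)`-bimodule `K`, regarded as a left `R`-module. -/
def BimoduleHom (S R K N : Type*) [Ring S] [Ring R] [AddCommGroup K] [Module S K] [Module Rᵐᵒᵖ K]
    [SMulCommClass S Rᵐᵒᵖ K] [AddCommGroup N] [Module S N] : Type _ :=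
  K →ₗ[S] N

namespace BimoduleHom

variable (S R K N : Type*) [Ring S] [Ring R] [AddCommGroup K] [Module S K] [Module Rᵐᵒᵖ K]
    [SMulCommClass S Rᵐᵒᵖ K] [AddCommGroup N] [Module S N]

instance : AddCommGroup (BimoduleHom S R K N) :=
  inferInstanceAs (AddCommGroup (K →ₗ[S] N))

instance : FunLike (BimoduleHom S R K N) K N :=
  inferInstanceAs (FunLike (K →ₗ[S] N) K N)

instance : LinearMapClass (BimoduleHom S R K N) S K N :=
  inferInstanceAs (LinearMapClass (K →ₗ[S] N) S K N)

instance : Module R (BimoduleHom S R K N) where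
  smul r φ :=
    { toFun := fun x => φ (op r • x)
      map_add' := fun x y => by rw [smul_add, map_add]
      map_smul' := fun s x => by rw [← smul_comm, map_smul, RingHom.id_apply] }
  one_smul φ := LinearMap.ext fun x => congrArg φ (one_smul Rᵐᵒᵖ x)
  mul_smul r r' φ := LinearMap.ext fun x => congrArg φ (mul_smul (op r') (op r) x)
  smul_zero _ := rfl
  smul_add _ _ _ := rfl
  add_smul r r' φ := LinearMap.ext fun x =>
    (congrArg φ (add_smul (op r) (op r') x)).trans (map_add φ _ _)
  zero_smul φ := LinearMap.ext fun x => (congrArg φ (zero_smul Rᵐᵒᵖ x)).trans (map_zero φ)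

variable {S R K N}

variable (S R K N) in
/-- The evaluation map `K ⊗_R Hom_S(K, N) → N` as a homomorphism of groups. -/
noncomputable def evaluationAddHom : BalancedTensor S R K (BimoduleHom S R K N) →+ N :=
  BalancedTensor.lift (AddMonoidHom.mk' (fun x => AddMonoidHom.mk'
    (fun φ : BimoduleHom S R K N => φ x) fun _ _ => rfl)
      fun x y => AddMonoidHom.ext fun φ => map_add φ x y) fun _ _ _ => rfl

variable (S R K N) in
/-- The evaluation map `K ⊗_R Hom_S(K, N) → N`. -/
noncomputable def evaluation : BalancedTensor S R K (BimoduleHom S R K N) →ₗ[S] N where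
  __ := evaluationAddHom S R K N
  map_smul' s t := by
    change evaluationAddHom S R K N (s • t) = s • evaluationAddHom S R K N t
    induction t using BalancedTensor.induction_on with
    | zero => rw [smul_zero, map_zero, smul_zero]
    | tmul x φ => exact map_smul φ s x
    | add t t' h h' => rw [smul_add, map_add, map_add, smul_add, h, h']

end BimoduleHom

/-! ### The four implications -/

section Main

variable {S R T : Type u} [Ring S] [Ring R] [Ring T] {n d : ℕ}

/-- The flat module is F = Hom_S(K, N), flat because F^* ≅ I. Under the adjunction the dual of
evaluation K ⊗_R F → N is composition of α with θ, hence bijective. The isomorphism τ allows both T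
= Rᵐᵒᵖ and a ring whose double opposite acts. -/
theorem IsSyzygyDualizing.isRelNDFlat {K : Type u} [AddCommGroup K] [Module S K] [Module Rᵐᵒᵖ K]
    [SMulCommClass S Rᵐᵒᵖ K] [Module T K] [SMulCommClass S T K] (τ : T ≃+* Rᵐᵒᵖ)
    (hτ : ∀ (t : T) (x : K), t • x = τ t • x) (h : IsSyzygyDualizing S T K d)
    {I : Type u} [AddCommGroup I] [Module T I] (hI : IsNDInjective T n d I)
    {N : Type u} [AddCommGroup N] [Module S N] (α : CharacterModule N ≃+ (K →ₗ[T] I))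
    (hα : ∀ (s : S) (f : CharacterModule N) (x : K), α (op s • f) x = α f (s • x)) :
    IsRelNDFlat S R n d K N := by
  obtain ⟨θ, hθ, hθ'⟩ := h.exists_addEquiv_characterModule hI α hα
  let θ' : I ≃+ CharacterModule (BimoduleHom S R K N) := θ
  have hsmul : ∀ (t : T) (y : I), θ' (t • y) = τ t • θ' y := fun t y =>
    CharacterModule.ext _ fun φ => hθ' t y φ (unop (τ t) • φ) fun x =>
      (congrArg φ (hτ t x)).symm
  have hchar : ∀ f t, BalancedTensor.characterEquiv (CharacterModule.precompHom
      (BimoduleHom.evaluation S R K N).toAddMonoidHom f) t = θ' (α f t) := fun f t => (hθ f t).symm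
  have hbij : Function.Bijective (BimoduleHom.evaluation S R K N).toAddMonoidHom := by
    refine CharacterModule.bijective_of_precompHom ⟨(injective_iff_map_eq_zero _).2 fun f hf => ?_,
      fun c => ?_⟩
    · have h0 : α f = 0 := LinearMap.ext fun x => θ'.injective <| by
        rw [← hchar, hf, map_zero]
        exact (map_zero θ').symm
      exact (map_eq_zero_iff α α.injective).1 h0
    · let g := BalancedTensor.characterEquiv c
      let ψ : K →ₗ[T] I :=
        { toFun := fun x => θ'.symm (g x)
          map_add' := fun x y => by rw [map_add, map_add]
          map_smul' := fun t x => θ'.injective <| by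
            rw [RingHom.id_apply, hsmul, θ'.apply_symm_apply, θ'.apply_symm_apply, hτ, map_smul] }
      refine ⟨α.symm ψ, BalancedTensor.characterEquiv.injective (LinearMap.ext fun x => ?_)⟩
      rw [hchar, α.apply_symm_apply]
      exact θ'.apply_symm_apply (g x)
  refine ⟨BimoduleHom S R K N, inferInstance, inferInstance,
    isNDFlat_iff_isNDInjective_characterModule.2 (hI.of_ringEquiv τ θ' hsmul),
    ⟨(LinearEquiv.ofBijective (BimoduleHom.evaluation S R K N) hbij).symm⟩⟩

variable {C K : Type u} [AddCommGroup C] [Module S C] [Module Rᵐᵒᵖ C] [SMulCommClass S Rᵐᵒᵖ C]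
  [AddCommGroup K] [Module S K] [Module Rᵐᵒᵖ K] [SMulCommClass S Rᵐᵒᵖ K]

theorem IsSpecialSemidualizing.isSyzygyDualizing (hK : IsSpecialSemidualizing S R d C K) :
    IsSyzygyDualizing S Rᵐᵒᵖ K d where
  nonempty := by
    obtain ⟨P, hP⟩ := hK.left_syzygy
    exact hP.nonempty
  ext j := hK.semidualizing.left_ext (j + 1) (Nat.le_add_left 1 j)
  homothety φ := by
    obtain ⟨r, hr⟩ := hK.semidualizing.right_homothety.2 φ
    exact ⟨op r, fun x => (LinearMap.congr_fun hr x).symm⟩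
  faithful t ht := unop_injective (hK.semidualizing.right_homothety.1 (LinearMap.ext fun x => by
    exact (ht x).trans (zero_smul Rᵐᵒᵖ x).symm))
  syzygy := ⟨C, inferInstance, inferInstance, hK.right_syzygy⟩

theorem IsSpecialSemidualizing.isSyzygyDualizing_op (hK : IsSpecialSemidualizing S R d C K) :
    IsSyzygyDualizing Rᵐᵒᵖ S K d where
  nonempty := by
    obtain ⟨P, hP⟩ := hK.right_syzygy
    exact hP.nonempty
  ext j := hK.semidualizing.right_ext (j + 1) (Nat.le_add_left 1 j)
  homothety φ := by
    obtain ⟨s, hs⟩ := hK.semidualizing.left_homothety.2 φ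
    exact ⟨s, fun x => (LinearMap.congr_fun hs x).symm⟩
  faithful s hs := hK.semidualizing.left_homothety.1 (LinearMap.ext fun x =>
    (hs x).trans (zero_smul S x).symm)
  syzygy := ⟨C, inferInstance, inferInstance, hK.left_syzygy⟩

theorem IsRelNDFlat.isRelNDInjective_characterModule {N : Type u} [AddCommGroup N] [Module S N]
    (h : IsRelNDFlat S R n d K N) :
    IsRelNDInjective Rᵐᵒᵖ Sᵐᵒᵖ n d (OppositeBimodule K) (CharacterModule N) := by
  obtain ⟨F, _, _, hF, ⟨e⟩⟩ := h
  let e₁ : CharacterModule N ≃+ CharacterModule (BalancedTensor S R K F) :=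
    CharacterModule.congrAddEquiv e.toAddEquiv
  refine ⟨CharacterModule F, inferInstance, inferInstance,
    isNDFlat_iff_isNDInjective_characterModule.1 hF, e₁.trans BalancedTensor.characterEquiv,
    fun s f x => CharacterModule.ext _ fun b => ?_⟩
  exact congrArg f (map_smul e.symm (unop s) (BalancedTensor.tmul S R (show K from x) b)).symm

theorem IsSpecialSemidualizing.isRelNDFlat_of_characterModule
    (hK : IsSpecialSemidualizing S R d C K) {N : Type u} [AddCommGroup N] [Module S N]
    (h : IsRelNDInjective Rᵐᵒᵖ Sᵐᵒᵖ n d (OppositeBimodule K) (CharacterModule N)) :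
    IsRelNDFlat S R n d K N := by
  obtain ⟨I, _, _, hI, e, he⟩ := h
  exact hK.isSyzygyDualizing.isRelNDFlat (RingEquiv.refl Rᵐᵒᵖ) (fun _ _ => rfl) hI
    (show CharacterModule N ≃+ (K →ₗ[Rᵐᵒᵖ] I) from e) fun s f x => he (op s) f x

/-- The previous criterion applies to N = M^*, because M^{**} ≅ Hom_S(K, I)^{**} ≅ Hom_S(K, I^{**}).
-/
theorem IsSpecialSemidualizing.isRelNDFlat_characterModule
    (hK : IsSpecialSemidualizing S R d C K) (hn : d + 1 < n) {M : Type u} [AddCommGroup M]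
    [Module R M] (h : IsRelNDInjective S R n d K M) :
    IsRelNDFlat Rᵐᵒᵖ Sᵐᵒᵖ n d (OppositeBimodule K) (CharacterModule M) := by
  obtain ⟨I, _, _, hI, e, he⟩ := h
  have : SMulCommClass Rᵐᵒᵖ S K := SMulCommClass.symm _ _ _
  obtain ⟨P⟩ := (hK.isSyzygyDualizing_op.isFP 1).nonempty_matrixPresentation
  let δ : DoubleDual (K →ₗ[S] I) ≃+ (K →ₗ[S] DoubleDual I) :=
    AddEquiv.ofBijective _ (P.bijective_doubleDualHom (I := I))
  let ε : CharacterModule (CharacterModule M) ≃+ DoubleDual (K →ₗ[S] I) :=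
    CharacterModule.congrAddEquiv (CharacterModule.congrAddEquiv e)
  let : Module S (OppositeBimodule K) := inferInstanceAs (Module S K)
  have : SMulCommClass Rᵐᵒᵖ S (OppositeBimodule K) :=
    ⟨fun r s x => (smul_comm s r (show K from x)).symm⟩
  have h' : IsSyzygyDualizing Rᵐᵒᵖ S (OppositeBimodule K) d := hK.isSyzygyDualizing_op
  refine h'.isRelNDFlat (RingEquiv.opOp S) (fun _ _ => rfl)
    ((isNDInjective_iff_doubleDual hn).1 hI) (ε.trans δ)
    fun r Φ x => CharacterModule.ext _ fun f => ?_
  refine congrArg Φ (CharacterModule.ext _ fun m => congrArg f ?_)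
  exact he (unop r) m x

/-- The injective module is I = K ⊗_R M. From M^{**} ≅ Hom_S(K, F^*) the key isomorphism gives F^* ≅
Hom(K, M^*)^* ≅ I^{**}, so I is (n,d)-injective. The unit M → Hom_S(K, I) is bijective because its
double dual is. -/
theorem IsSpecialSemidualizing.isRelNDInjective_of_characterModule
    (hK : IsSpecialSemidualizing S R d C K) (hn : d + 1 < n) {M : Type u} [AddCommGroup M]
    [Module R M]
    (h : IsRelNDFlat Rᵐᵒᵖ Sᵐᵒᵖ n d (OppositeBimodule K) (CharacterModule M)) :
    IsRelNDInjective S R n d K M := by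
  obtain ⟨F, _, _, hF, ⟨E⟩⟩ := h
  let : Module S (CharacterModule F) := Module.compHom _ (RingEquiv.opOp S).toRingHom
  have : SMulCommClass Rᵐᵒᵖ S K := SMulCommClass.symm _ _ _
  have hJ : IsNDInjective S n d (CharacterModule F) :=
    (isNDFlat_iff_isNDInjective_characterModule.1 hF).of_ringEquiv (RingEquiv.opOp S).symm
      (AddEquiv.refl _) fun _ _ => rfl
  let e₁ : CharacterModule (CharacterModule M) ≃+
      CharacterModule (BalancedTensor Rᵐᵒᵖ Sᵐᵒᵖ (OppositeBimodule K) F) :=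
    CharacterModule.congrAddEquiv E.toAddEquiv
  let e₂ : (OppositeBimodule K →ₗ[Sᵐᵒᵖᵐᵒᵖ] CharacterModule F) ≃+ (K →ₗ[S] CharacterModule F) :=
    { toFun := fun φ =>
        { toFun := φ
          map_add' := φ.map_add
          map_smul' := fun s x => φ.map_smul (op (op s)) x }
      invFun := fun φ =>
        { toFun := φ
          map_add' := φ.map_add
          map_smul' := fun s x => φ.map_smul (unop (unop s)) x }
      left_inv := fun _ => rfl
      right_inv := fun _ => rfl
      map_add' := fun _ _ => rfl }
  let α : CharacterModule (CharacterModule M) ≃+ (K →ₗ[S] CharacterModule F) :=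
    (e₁.trans BalancedTensor.characterEquiv).trans e₂
  obtain ⟨θ, hθ, hθ'⟩ := hK.isSyzygyDualizing_op.exists_addEquiv_characterModule hJ α
    fun r Φ x => CharacterModule.ext _ fun b => congrArg Φ
      (map_smul E.symm r (BalancedTensor.tmul Rᵐᵒᵖ Sᵐᵒᵖ (show OppositeBimodule K from x) b)).symm
  let I := BalancedTensor S R K M
  let c : (K →ₗ[Rᵐᵒᵖ] CharacterModule M) ≃+ CharacterModule I :=
    BalancedTensor.characterEquiv.symm
  let δ : CharacterModule F ≃+ DoubleDual I :=
    θ.trans (CharacterModule.congrAddEquiv c)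
  have hδ : ∀ (s : S) y, δ (s • y) = s • δ y := fun s y => CharacterModule.ext _ fun g =>
    hθ' s y (c.symm g) (c.symm (op s • g)) fun x => rfl
  have hI : IsNDInjective S n d I := (isNDInjective_iff_doubleDual hn).2
    (hJ.of_ringEquiv (RingEquiv.refl S) δ hδ)
  let η : M →+ (K →ₗ[S] I) := AddMonoidHom.mk' (fun m =>
    { toFun := fun x => BalancedTensor.tmul S R x m
      map_add' := fun x y => BalancedTensor.add_tmul x y m
      map_smul' := fun s x => rfl }) fun m m' =>
        LinearMap.ext fun x => BalancedTensor.tmul_add x m m'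
  -- After identifying Hom_S(K, I)^{**} with Hom_S(K, I^{**}), the double dual of η is α followed by
  -- δ, both isomorphisms.
  have hη' : ∀ Φ x, doubleDualHom S K I (CharacterModule.precompHom
      (CharacterModule.precompHom η) Φ) x = δ (α Φ x) := fun Φ x =>
    CharacterModule.ext _ fun g => (DFunLike.congr_fun (hθ Φ x) (c.symm g)).symm
  obtain ⟨P⟩ := (hK.isSyzygyDualizing_op.isFP 1).nonempty_matrixPresentation
  have hη : Function.Bijective η := by
    refine CharacterModule.bijective_of_precompHom (CharacterModule.bijective_of_precompHom
      ⟨(injective_iff_map_eq_zero _).2 fun Φ hΦ => ?_, fun Ψ => ?_⟩)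
    · have h0 : α Φ = 0 := LinearMap.ext fun x => δ.injective <| by
        rw [← hη', hΦ]
        exact (LinearMap.congr_fun (map_zero (doubleDualHom S K I)) x).trans (map_zero δ).symm
      exact (map_eq_zero_iff α α.injective).1 h0
    · let ψ : K →ₗ[S] CharacterModule F :=
        { toFun := fun x => δ.symm (doubleDualHom S K I Ψ x)
          map_add' := fun x y => by rw [map_add, map_add]
          map_smul' := fun s x => δ.injective <| by
            rw [RingHom.id_apply, hδ, δ.apply_symm_apply, δ.apply_symm_apply, map_smul] }
      refine ⟨α.symm ψ, (P.bijective_doubleDualHom (I := I)).1 (LinearMap.ext fun x => ?_)⟩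
      rw [hη', α.apply_symm_apply]
      exact δ.apply_symm_apply _
  exact ⟨I, inferInstance, inferInstance, hI, AddEquiv.ofBijective η hη, fun r m x =>
    (BalancedTensor.op_smul_tmul r x m).symm⟩

end Main

theorem mainTheorem8 (S R : Type u) [Ring S] [Ring R] (n d : ℕ) (hd : 1 ≤ d) (hn : d + 1 < n)
    (C K : Type u)
    [AddCommGroup C] [Module S C] [Module Rᵐᵒᵖ C] [SMulCommClass S Rᵐᵒᵖ C]
    [AddCommGroup K] [Module S K] [Module Rᵐᵒᵖ K] [SMulCommClass S Rᵐᵒᵖ K]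
    (hK : IsSpecialSemidualizing S R d C K) :
    (∀ (M : Type u) [AddCommGroup M] [Module R M],
      IsRelNDInjective S R n d K M ↔
        IsRelNDFlat Rᵐᵒᵖ Sᵐᵒᵖ n d (OppositeBimodule K) (CharacterModule M)) ∧
    (∀ (N : Type u) [AddCommGroup N] [Module S N],
      IsRelNDFlat S R n d K N ↔
        IsRelNDInjective Rᵐᵒᵖ Sᵐᵒᵖ n d (OppositeBimodule K) (CharacterModule N)) :=
  ⟨fun _ _ _ => ⟨hK.isRelNDFlat_characterModule hn, hK.isRelNDInjective_of_characterModule hn⟩,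
    fun _ _ _ => ⟨fun h => h.isRelNDInjective_characterModule, hK.isRelNDFlat_of_characterModule⟩⟩
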